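/- **Setting.** For each site $n\in\mathbb Z$ and each sign $\pm$ let $\phi_{\pm n},F_{\pm n}$ be bosonic (commuting) and $\chi_{\pm n},\bar\chi_{\pm n}$ fermionic (anticommuting) variables, with fermion number $N_F=0$ for $\phi_\pm,F_\pm$, $N_F=1$ for $\chi_\pm$ and $N_F=-1$ for $\bar\chi_\pm$. A coefficient $C_{m_0m_1\cdots m_I}\in\mathbb C$ ($I\ge 0$, $m_i\in\mathbb Z$) is called a TILC (translationally invariant local coefficient) if $C_{m_0+1,\dots,m_I+1}=C_{m_0,\dots,m_I}$ and there are $L,M>0$ with $|C_{m_0\cdots m_I}|<L\,e^{-M|m_0-m_i|}$ for all $i$ and all sites. A local functional is a formal sum, without constant term, of expressions $\sum_{m_0,\dots,m_I}C_{m_0\cdots m_I}X^{(0)}_{m_0}\cdots X^{(I)}_{m_I}$, where each $X^{(i)}$ is one of the eight fields and $C$ is a TILC; the set of orders $I+1$ that occur may be finite or infinite. Let $\nabla=(\nabla_{mn})$ be a local difference operator, i.e. a nonzero TILC with $\sum_n\nabla_{mn}=0$, and put $(\nabla f)_m=\sum_n\nabla_{mn}f_n$. Let $Q_+$ and $Q_-$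 be the odd (left) derivations with $$Q_+\phi_+=\bar\chi_+,\quad Q_+\chi_+=F_+,\quad Q_+\chi_-=-i\nabla\phi_-,\quad Q_+F_-=-i\nabla\bar\chi_-,$$ $$Q_-\phi_-=-\bar\chi_-,\quad Q_-\chi_-=F_-,\quad Q_-\chi_+=i\nabla\phi_+,\quad Q_-F_+=-i\nabla\bar\chi_+$$ at every site, and $Q_\pm=0$ on the remaining fields. The $\pm$type CLR terms with $N_F=1$ are the functionals $$\sum_{k\ge 0}\ \sum_{m,n_1,\dots,n_k}C^{(k)}_{mn_1\cdots n_k}\,\chi_{\pm m}\phi_{\pm n_1}\cdots\phi_{\pm n_k},$$ where each $C^{(k)}$ is a TILC, totally symmetric in its last $k$ indices, that satisfies the cyclic Leibniz rule $$\sum_{p}\sum_m\nabla_{mn_{p(0)}}C^{(k)}_{mn_{p(1)}\cdots n_{p(k)}}=0\qquad\text{for all }n_0,\dots,n_k,$$ $p$ running over the cyclic permutations of $\{0,\dots,k\}$. **Proposition.** Let $S$ be a local functional with $N_F=0$ such that $Q_+S=Q_-S=0$. Then there are a local functional $T$ with $N_F=2$, a sum $\mathcal C_+$ of $+$type CLR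 terms with $N_F=1$ and a sum $\mathcal C_-$ of $-$type CLR terms with $N_F=1$ such that $$S=Q_+Q_-T+Q_+\mathcal C_++Q_-\mathcal C_-.$$ Moreover $T,\mathcal C_+,\mathcal C_-$ can be chosen to contain only orders in the fields that occur in $S$; in particular they are finite sums if $S$ is. -/

import Mathlib

namespace LatticeSUSY

/-- The label `±` carried by the fields. -/
inductive Sgn
  | plus
  | minus
  deriving DecidableEq

instance : Fintype Sgn := ⟨{.plus, .minus}, by intro x; cases x <;> decide⟩

/-- The four kinds of fields: the bosons `φ`, `F` and the fermions `χ`, `χ̄`. -/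
inductive Kind
  | phi
  | chibar
  | chi
  | aux
  deriving DecidableEq

instance : Fintype Kind := ⟨{.phi, .chibar, .chi, .aux}, by intro x; cases x <;> decide⟩

/-- The eight field species `φ_±, χ̄_±, χ_±, F_±`.  A field variable is a species together with a
site of the lattice `ℤ`. -/
abbrev Species : Type := Kind × Sgn

/-- Fermion number: `1` for `χ_±`, `-1` for `χ̄_±`, `0` for `φ_±` and `F_±`. -/
def fermionNumber : Species → ℤ
  | (.chi, _) => 1
  | (.chibar, _) => -1
  | (.phi, _) => 0
  | (.aux, _) => 0

/-- The fermionic (Grassmann odd) species. -/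
def isOdd : Species → Bool
  | (.chi, _) => true
  | (.chibar, _) => true
  | (.phi, _) => false
  | (.aux, _) => false

/-- The coefficients of a formal sum of monomials in the fields,
`S = ∑_I ∑_w ∑_m S I w m • X_{w 0, m 0} X_{w 1, m 1} ⋯ X_{w I, m I}`,
where `w` runs over the words of `I + 1` species, `m` over the `(I + 1)`-tuples of sites, and
`X_{a, m}` is the field variable of species `a` at the site `m`.  Every monomial contains at least
one field; the sum over the order `I + 1` may be finite or infinite. -/
abbrev Functional : Type :=
  (I : ℕ) → (Fin (I + 1) → Species) → (Fin (I + 1) → ℤ) → ℂ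

/-- Graded symmetry under exchange of two neighbouring factors.  Since bosonic variables commute
with everything and fermionic variables anticommute among each other, a formal sum of monomials is
given by exactly one family of coefficients with this symmetry, so that two functionals are equal
if and only if these coefficients are. -/
def IsGradedSymmetric (S : Functional) : Prop :=
  ∀ (I : ℕ) (w : Fin (I + 1) → Species) (m : Fin (I + 1) → ℤ) (i : Fin I),
    S I (w ∘ Equiv.swap i.castSucc i.succ) (m ∘ Equiv.swap i.castSucc i.succ) =
      (if isOdd (w i.castSucc) && isOdd (w i.succ) then -1 else 1) * S I w m

/-- Translationally invariant local coefficient (TILC): invariant under the simultaneous shift of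
all sites, and exponentially decaying in each of the site differences. -/
def IsTILC {I : ℕ} (C : (Fin (I + 1) → ℤ) → ℂ) : Prop :=
  (∀ m : Fin (I + 1) → ℤ, C (fun i => m i + 1) = C m) ∧
  ∃ L > (0 : ℝ), ∃ M > (0 : ℝ), ∀ (m : Fin (I + 1) → ℤ) (i : Fin (I + 1)),
    ‖C m‖ < L * Real.exp (-M * (|m 0 - m i| : ℤ))

/-- A local functional: all its coefficients are TILCs. -/
def IsLocalFunctional (S : Functional) : Prop :=
  IsGradedSymmetric S ∧ ∀ (I : ℕ) (w : Fin (I + 1) → Species), IsTILC (S I w)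

/-- Every monomial occurring in `S` has fermion number `N`. -/
def HasFermionNumber (S : Functional) (N : ℤ) : Prop :=
  ∀ (I : ℕ) (w : Fin (I + 1) → Species) (m : Fin (I + 1) → ℤ),
    S I w m ≠ 0 → ∑ i, fermionNumber (w i) = N

/-- A local difference operator `(∇ f)_m = ∑_n ∇_{mn} f_n`: a nonzero TILC that annihilates the
constants. -/
structure IsDifferenceOperator (D : ℤ → ℤ → ℂ) : Prop where
  tilc : IsTILC (fun m : Fin 2 → ℤ => D (m 0) (m 1))
  map_const : ∀ m, HasSum (fun n => D m n) 0
  ne_zero : D ≠ 0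

/-- The Grassmann sign picked up by an odd operator on its way to the `j`-th factor of a word. -/
def passSign {I : ℕ} (w : Fin (I + 1) → Species) (j : Fin (I + 1)) : ℂ :=
  ∏ i ∈ Finset.univ.filter (fun i => i < j), if isOdd (w i) then -1 else 1

/-- The odd derivation acting from the left with `X_{a, l} ↦ ∑_b ∑_n A a b l n • X_{b, n}` on the
field variables: it replaces the factors of a monomial one after the other, and the coefficients of
the resulting monomials are collected. -/
noncomputable def oddDerivation (A : Species → Species → ℤ → ℤ → ℂ) (S : Functional) : Functional :=
  fun _ w m => ∑ j, passSign w j * ∑ a : Species, ∑' l : ℤ,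
    A a (w j) l (m j) * S _ (Function.update w j a) (Function.update m j l)

/-- `δ_{mn}` -/
def kronecker (m n : ℤ) : ℂ := if m = n then 1 else 0

/-- `δ_+ φ_+ = χ̄_+`, `δ_+ χ_+ = F_+`, `δ_+ χ_- = -i ∇φ_-`, `δ_+ F_- = -i ∇χ̄_-`, and `δ_+` of the
other fields is zero. -/
noncomputable def deltaPlus (D : ℤ → ℤ → ℂ) : Species → Species → ℤ → ℤ → ℂ
  | (.phi, .plus), (.chibar, .plus), m, n => kronecker m n
  | (.chi, .plus), (.aux, .plus), m, n => kronecker m n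
  | (.chi, .minus), (.phi, .minus), m, n => -Complex.I * D m n
  | (.aux, .minus), (.chibar, .minus), m, n => -Complex.I * D m n
  | _, _, _, _ => 0

/-- `δ_- φ_- = -χ̄_-`, `δ_- χ_- = F_-`, `δ_- χ_+ = i ∇φ_+`, `δ_- F_+ = -i ∇χ̄_+`, and `δ_-` of the
other fields is zero. -/
noncomputable def deltaMinus (D : ℤ → ℤ → ℂ) : Species → Species → ℤ → ℤ → ℂ
  | (.phi, .minus), (.chibar, .minus), m, n => -kronecker m n
  | (.chi, .minus), (.aux, .minus), m, n => kronecker m n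
  | (.chi, .plus), (.phi, .plus), m, n => Complex.I * D m n
  | (.aux, .plus), (.chibar, .plus), m, n => -Complex.I * D m n
  | _, _, _, _ => 0

/-- The supercharge `Q_+`. -/
noncomputable def Qplus (D : ℤ → ℤ → ℂ) : Functional → Functional :=
  oddDerivation (deltaPlus D)

/-- The supercharge `Q_-`. -/
noncomputable def Qminus (D : ℤ → ℤ → ℂ) : Functional → Functional :=
  oddDerivation (deltaMinus D)

/-- A CLR coefficient `C_{m n_1 ⋯ n_k}`: a TILC, totally symmetric in the last `k` indices, which
satisfies the cyclic Leibniz rule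
`∑_{p cyclic} ∑_m ∇_{m n_{p(0)}} C_{m n_{p(1)} ⋯ n_{p(k)}} = 0`.
(The addition in `Fin (k + 1)` is modulo `k + 1`.) -/
structure IsCLRCoefficient (D : ℤ → ℤ → ℂ) {k : ℕ} (C : (Fin (k + 1) → ℤ) → ℂ) : Prop where
  tilc : IsTILC C
  symm : ∀ (σ : Equiv.Perm (Fin k)) (m : ℤ) (n : Fin k → ℤ),
    C (Fin.cons m (n ∘ σ)) = C (Fin.cons m n)
  clr : ∀ n : Fin (k + 1) → ℤ,
    ∑ p : Fin (k + 1), ∑' m : ℤ,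
      D m (n p) * C (Fin.cons m (fun i : Fin k => n (p + i.succ))) = 0

/-- The functional `∑_k ∑_{m, n_1, …, n_k} C_{m n_1 ⋯ n_k} χ_{s m} φ_{s n_1} ⋯ φ_{s n_k}` for
coefficients `C` symmetric in `n_1, …, n_k`.  Its graded-symmetric coefficients distribute each `C`
equally over the `k + 1` positions `j` that `χ` can take among the bosonic factors. -/
noncomputable def chiPhiFunctional (s : Sgn) (C : (k : ℕ) → (Fin (k + 1) → ℤ) → ℂ) : Functional :=
  fun k w m => (1 / ((k : ℂ) + 1)) * ∑ j : Fin (k + 1),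
    if w = (fun i => if i = j then (Kind.chi, s) else (Kind.phi, s)) then
      C k (Fin.cons (m j) (fun i : Fin k => m (j.succAbove i)))
    else 0

/-- `P` is a sum of `s`-type CLR terms (with fermion number `1`), `s = ±`. -/
def IsCLRTerms (D : ℤ → ℤ → ℂ) (s : Sgn) (P : Functional) : Prop :=
  ∃ C : (k : ℕ) → (Fin (k + 1) → ℤ) → ℂ,
    (∀ k, IsCLRCoefficient D (C k)) ∧ P = chiPhiFunctional s C

end LatticeSUSY

open LatticeSUSY

/-! ### Laurent series and the division kernel -/

namespace LatticeSUSY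

open Real Set Filter Topology

/-! Both supercharges preserve the number of factors and the label `±` of each factor. So the claim
splits by order, and within an order into words with all labels `+`, all labels `-`, or both labels.
On the `+` fields Q_+ has a contracting homotopy h_+ (χ̄_+ ↦ φ_+, F_+ ↦ χ_+): the anticommutator of
Q_+ and h_+ counts the `+` letters, while h_+ anticommutes with Q_-. The same holds with the labels
exchanged.

On mixed words both counts n_± are nonzero, and Q_+ Q_- h_+ h_- S = -n_+ n_- S yields T
(`exists_mixed`). On pure `+` words of order N, R = h_+ S / N has fermion number 1 and satisfies Q_+
R = S, Q_- R = 0 (`exists_pure`). There Q_- is a Koszul differential χ ↦ i∇φ, F ↦ -i∇χ̄. Grade R by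
the number of up letters χ, F; fermion number 1 forces at least one. With exactly one, the word
consists of one χ and otherwise φ, and being a cycle is the cyclic Leibniz rule
(`exists_isCLRCoefficient`). With two or more, the cycle is a boundary (`exists_koszul_primitive`).
Hence R = Q_- U + C and S = Q_+ Q_- U + Q_+ C.

The analytic core is exactness within exponentially decaying coefficients, although ∇ kills
constants and so has no local inverse. Take the first site as origin. The Laurent series of ∇ may
vanish on the unit circle, but not on the circles of radius exp(±r) for suitable small r. Its
reciprocals there give two convolution inverses; taking one for targets m ≥ 0 and the other for m <
0 gives a left inverse of ∇ that keeps decay (`exists_division_kernel`). A left inverse suffices: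
applied in factor j it anticommutes with the differential in the other factors, so it removes from a
cycle all words with an up letter at j (`exists_elimination`). The origin itself cannot be divided,
so two up letters are required: one of them lies elsewhere. The choice of origin breaks graded
symmetry, which averaging over permutations restores. -/

lemma _root_.HasSum.congr_fun' {ι α : Type*} [AddCommMonoid α] [TopologicalSpace α] {f g : ι → α}
    {a : α} (h : HasSum f a) (hfg : ∀ i, f i = g i) : HasSum g a :=
  (funext hfg : f = g) ▸ h

lemma summable_exp_neg_mul_abs {c : ℝ} (hc : 0 < c) :
    Summable fun n : ℤ => Real.exp (-c * |(n : ℝ)|) := by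
  have h : Summable fun n : ℕ => Real.exp (-c * (n : ℝ)) := by
    have := Real.summable_exp_nat_mul_iff.mpr (neg_lt_zero.mpr hc)
    refine this.congr fun n => by rw [mul_comm]
  exact Summable.of_nat_of_neg (by simpa using h) (by simpa using h)

/-- The Laurent series of `f`, as a function of the logarithm of its variable. -/
noncomputable def expSeries (f : ℤ → ℂ) (x : ℂ) : ℂ := ∑' n : ℤ, f n * Complex.exp (n * x)

lemma norm_mul_exp_le {f : ℤ → ℂ} {L M : ℝ}
    (hf : ∀ n : ℤ, ‖f n‖ ≤ L * Real.exp (-M * |(n : ℝ)|)) {x : ℂ} (hx : |x.re| < M / 2) (n : ℤ) :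
    ‖f n * Complex.exp (n * x)‖ ≤ L * Real.exp (-(M / 2) * |(n : ℝ)|) := by
  have hL : 0 ≤ L := by simpa using (norm_nonneg _).trans (hf 0)
  rw [norm_mul, Complex.norm_exp]
  have h1 : ((n : ℂ) * x).re ≤ M / 2 * |(n : ℝ)| := by
    have : ((n : ℂ) * x).re = n * x.re := by simp
    rw [this]
    calc (n : ℝ) * x.re ≤ |(n : ℝ) * x.re| := le_abs_self _
      _ = |x.re| * |(n : ℝ)| := by rw [abs_mul, mul_comm]
      _ ≤ _ := by gcongr
  calc ‖f n‖ * Real.exp ((n : ℂ) * x).re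
      ≤ (L * Real.exp (-M * |(n : ℝ)|)) * Real.exp (M / 2 * |(n : ℝ)|) := by
        gcongr
        exact hf n
    _ = _ := by rw [mul_assoc, ← Real.exp_add]; ring_nf

lemma summable_mul_exp {f : ℤ → ℂ} {L M : ℝ} (hM : 0 < M)
    (hf : ∀ n : ℤ, ‖f n‖ ≤ L * Real.exp (-M * |(n : ℝ)|)) {x : ℂ} (hx : |x.re| < M / 2) :
    Summable fun n : ℤ => f n * Complex.exp (n * x) :=
  .of_norm_bounded ((summable_exp_neg_mul_abs (half_pos hM)).mul_left L) (norm_mul_exp_le hf hx)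

lemma isOpen_strip (M : ℝ) : IsOpen {x : ℂ | |x.re| < M} :=
  isOpen_lt (by fun_prop) continuous_const

lemma convex_strip (M : ℝ) : Convex ℝ {x : ℂ | |x.re| < M} := by
  have : {x : ℂ | |x.re| < M} = Complex.reLm ⁻¹' Set.Ioo (-M) M := by
    ext x; simp [abs_lt]
  rw [this]
  exact (convex_Ioo _ _).linear_preimage _

lemma analyticOnNhd_expSeries {f : ℤ → ℂ} {L M : ℝ} (hM : 0 < M)
    (hf : ∀ n : ℤ, ‖f n‖ ≤ L * Real.exp (-M * |(n : ℝ)|)) :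
    AnalyticOnNhd ℂ (expSeries f) {x : ℂ | |x.re| < M / 2} := by
  refine DifferentiableOn.analyticOnNhd ?_ (isOpen_strip _)
  refine Complex.differentiableOn_tsum_of_summable_norm
    ((summable_exp_neg_mul_abs (half_pos hM)).mul_left L) (fun i => ?_) (isOpen_strip _)
    (fun n x hx => norm_mul_exp_le hf hx n)
  fun_prop

/-- Termwise integration along a vertical line of the strip; the uniform exponential bound on the
terms is the dominating function. -/
lemma hasSum_integral_exp {f : ℤ → ℂ} {L M : ℝ} (hM : 0 < M)
    (hf : ∀ n : ℤ, ‖f n‖ ≤ L * Real.exp (-M * |(n : ℝ)|)) {t : ℝ} (ht : |t| < M / 2)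
    {g : ℝ → ℂ} (hg : Continuous g) :
    HasSum (fun l : ℤ => f l * ∫ θ in (0 : ℝ)..(2 * π), Complex.exp (l * (t + θ * Complex.I)) * g θ)
      (∫ θ in (0 : ℝ)..(2 * π), expSeries f (t + θ * Complex.I) * g θ) := by
  have hre : ∀ θ : ℝ, |((t : ℂ) + θ * Complex.I).re| < M / 2 := fun θ => by simpa using ht
  have hs := (summable_exp_neg_mul_abs (half_pos hM)).mul_left L
  simp_rw [← intervalIntegral.integral_const_mul]
  refine intervalIntegral.hasSum_integral_of_dominated_convergence
    (fun l θ => L * Real.exp (-(M / 2) * |(l : ℝ)|) * ‖g θ‖) (fun l => ?_) (fun l => ?_) ?_ ?_ ?_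
  · exact Continuous.aestronglyMeasurable (by fun_prop)
  · refine .of_forall fun θ _ => ?_
    rw [← mul_assoc, norm_mul]
    gcongr
    exact norm_mul_exp_le hf (hre θ) l
  · exact .of_forall fun θ _ => hs.mul_right _
  · simp_rw [tsum_mul_right]
    exact Continuous.intervalIntegrable (by fun_prop) _ _
  · refine .of_forall fun θ _ => ?_
    simp_rw [← mul_assoc]
    exact (summable_mul_exp hM hf (hre θ)).hasSum.mul_right _

lemma integral_exp_int_mul (n : ℤ) (t : ℝ) :
    ∫ θ in (0 : ℝ)..(2 * π), Complex.exp (n * (t + θ * Complex.I)) =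
      if n = 0 then (2 * π : ℂ) else 0 := by
  split_ifs with h
  · subst h; simp
  · have : ∀ θ : ℝ, Complex.exp (n * (t + θ * Complex.I)) =
        Complex.exp (n * t) * Complex.exp (n * Complex.I * θ) := fun θ => by
      rw [← Complex.exp_add]; ring_nf
    simp_rw [this, intervalIntegral.integral_const_mul]
    rw [integral_exp_mul_complex (by simp [h])]
    have h2 : Complex.exp (n * Complex.I * ((2 * π : ℝ) : ℂ)) = 1 := by
      rw [show (n : ℂ) * Complex.I * ((2 * π : ℝ) : ℂ) = n * (2 * π * Complex.I) by push_cast; ring]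
      exact Complex.exp_int_mul_two_pi_mul_I n
    rw [h2]; simp

/-- The coefficients of `f` are the Fourier coefficients of the series on the imaginary axis. -/
lemma exists_expSeries_ne_zero {f : ℤ → ℂ} {L M : ℝ} (hM : 0 < M)
    (hf : ∀ n : ℤ, ‖f n‖ ≤ L * Real.exp (-M * |(n : ℝ)|)) (hf0 : f ≠ 0) :
    ∃ x : ℂ, |x.re| < M / 2 ∧ expSeries f x ≠ 0 := by
  by_contra! h
  apply hf0
  funext n
  have h0 : ∀ θ : ℝ, expSeries f (((0 : ℝ) : ℂ) + θ * Complex.I) = 0 := fun θ =>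
    h _ (by simpa using hM)
  have hs := hasSum_integral_exp hM hf (t := 0) (by simpa using hM)
    (g := fun θ => Complex.exp ((-n : ℤ) * (((0 : ℝ) : ℂ) + θ * Complex.I))) (by fun_prop)
  simp only [h0, ← Complex.exp_add, ← add_mul, ← Int.cast_add, integral_exp_int_mul] at hs
  have h1 := hs.tsum_eq
  rw [tsum_eq_single n] at h1
  · simpa [Real.pi_ne_zero] using h1
  · intro b hb
    rw [if_neg (by omega), mul_zero]

/-- By the identity theorem the zeros are isolated, and a discrete subset of the plane is countable.
-/
lemma countable_zeros_expSeries {f : ℤ → ℂ} {L M : ℝ} (hM : 0 < M)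
    (hf : ∀ n : ℤ, ‖f n‖ ≤ L * Real.exp (-M * |(n : ℝ)|)) (hf0 : f ≠ 0) :
    {x : ℂ | |x.re| < M / 2 ∧ expSeries f x = 0}.Countable := by
  set Z := {x : ℂ | |x.re| < M / 2 ∧ expSeries f x = 0} with hZ
  have hA := analyticOnNhd_expSeries hM hf
  obtain ⟨y, hy, hy0⟩ := exists_expSeries_ne_zero hM hf hf0
  have : DiscreteTopology Z := by
    rw [discreteTopology_subtype_iff]
    intro x hx
    have hev : ∀ᶠ z in 𝓝[≠] x, expSeries f z ≠ 0 := by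
      by_contra hcon
      have hfr : ∃ᶠ z in 𝓝[≠] x, expSeries f z = 0 := by
        rwa [Filter.Frequently]
      exact hy0 (hA.eqOn_zero_of_preconnected_of_frequently_eq_zero
        (convex_strip _).isPreconnected hx.1 hfr hy)
    rw [← disjoint_iff, Filter.disjoint_principal_right]
    filter_upwards [hev] with z hz hzZ using hz hzZ.2
  have : Countable Z := countable_of_Lindelof_of_discrete
  exact Set.countable_coe_iff.mp this

lemma exists_radius {f : ℤ → ℂ} {L M : ℝ} (hM : 0 < M)
    (hf : ∀ n : ℤ, ‖f n‖ ≤ L * Real.exp (-M * |(n : ℝ)|)) (hf0 : f ≠ 0) {ε : ℝ} (hε : 0 < ε) :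
    ∃ r, 0 < r ∧ r < ε ∧ r < M / 2 ∧ ∀ t : ℝ, |t| = r → ∀ θ : ℝ,
      expSeries f (t + θ * Complex.I) ≠ 0 := by
  have hc := (countable_zeros_expSeries hM hf hf0).image fun x => |x.re|
  have hlt : 0 < min ε (M / 2) := lt_min hε (half_pos hM)
  -- Only countably many values of |Re x| occur at zeros, but the interval is uncountable, so some
  -- radius avoids them on both lines Re x = ±r.
  have hne : ¬ Set.Ioo 0 (min ε (M / 2)) ⊆
      (fun x : ℂ => |x.re|) '' {x : ℂ | |x.re| < M / 2 ∧ expSeries f x = 0} := fun hsub =>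
    (Cardinal.Real.Ioo_countable_iff.not.mpr hlt.not_ge) (hc.mono hsub)
  obtain ⟨r, hr, hr'⟩ := Set.not_subset.mp hne
  refine ⟨r, hr.1, hr.2.trans_le (min_le_left _ _), hr.2.trans_le (min_le_right _ _), ?_⟩
  intro t ht θ h0
  refine hr' ⟨t + θ * Complex.I, ⟨?_, h0⟩, by simpa using ht⟩
  have : |((t : ℂ) + θ * Complex.I).re| = r := by simpa using ht
  rw [this]
  exact hr.2.trans_le (min_le_right _ _)

/-- The inverse of `f` for the convolution, read off the Laurent expansion of the reciprocal of the
Laurent series of `f` on a circle without zeros. -/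
lemma exists_convolution_inverse {f : ℤ → ℂ} {L M : ℝ} (hM : 0 < M)
    (hf : ∀ n : ℤ, ‖f n‖ ≤ L * Real.exp (-M * |(n : ℝ)|)) {t : ℝ} (ht : |t| < M / 2)
    (h0 : ∀ θ : ℝ, expSeries f (t + θ * Complex.I) ≠ 0) :
    ∃ (A : ℝ) (a : ℤ → ℂ), 0 < A ∧ (∀ n : ℤ, ‖a n‖ ≤ A * Real.exp (-t * n)) ∧
      ∀ n : ℤ, HasSum (fun l : ℤ => f l * a (n - l)) (if n = 0 then 1 else 0) := by
  have hre : ∀ θ : ℝ, |((t : ℂ) + θ * Complex.I).re| < M / 2 := fun θ => by simpa using ht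
  have hG : Continuous fun θ : ℝ => expSeries f (t + θ * Complex.I) :=
    (analyticOnNhd_expSeries hM hf).continuousOn.comp_continuous (by fun_prop) hre
  have hinv : Continuous fun θ : ℝ => (expSeries f (t + θ * Complex.I))⁻¹ := hG.inv₀ h0
  obtain ⟨B, hB⟩ := (isCompact_uIcc (a := (0 : ℝ)) (b := 2 * π)).exists_bound_of_continuousOn
    hinv.continuousOn
  have hB0 : 0 ≤ B := (norm_nonneg _).trans (hB 0 (by simp))
  -- The Fourier coefficients of the reciprocal on the line Re x = t. Using `B + 1` makes the
  -- constant positive.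
  refine ⟨B + 1, fun n => (2 * π : ℂ)⁻¹ * ∫ θ in (0 : ℝ)..(2 * π),
    Complex.exp ((-n : ℤ) * (t + θ * Complex.I)) * (expSeries f (t + θ * Complex.I))⁻¹,
    by positivity, fun n => ?_, fun n => ?_⟩
  · have h1 : ‖∫ θ in (0 : ℝ)..(2 * π), Complex.exp ((-n : ℤ) * (t + θ * Complex.I)) *
        (expSeries f (t + θ * Complex.I))⁻¹‖ ≤ Real.exp (-t * n) * B * |2 * π - 0| := by
      refine intervalIntegral.norm_integral_le_of_norm_le_const fun θ hθ => ?_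
      rw [norm_mul, Complex.norm_exp]
      have h2 : (((-n : ℤ) : ℂ) * (t + θ * Complex.I)).re = -t * n := by
        simp [mul_comm]
      rw [h2]
      gcongr
      exact hB θ (Set.uIoc_subset_uIcc hθ)
    have hpi : (0 : ℝ) < 2 * π := by positivity
    rw [norm_mul]
    have h3 : ‖(2 * π : ℂ)⁻¹‖ = (2 * π)⁻¹ := by
      rw [norm_inv, show (2 * π : ℂ) = ((2 * π : ℝ) : ℂ) by push_cast; ring, Complex.norm_real,
        Real.norm_of_nonneg hpi.le]
    rw [h3, sub_zero, abs_of_pos hpi] at *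
    calc (2 * π)⁻¹ * _ ≤ (2 * π)⁻¹ * (Real.exp (-t * n) * B * (2 * π)) := by gcongr
      _ = B * Real.exp (-t * n) := by field_simp
      _ ≤ (B + 1) * Real.exp (-t * n) := by gcongr; linarith
  · have hs := hasSum_integral_exp hM hf ht
      (g := fun θ => Complex.exp ((-n : ℤ) * (t + θ * Complex.I)) *
        (expSeries f (t + θ * Complex.I))⁻¹) (by fun_prop)
    have h1 : ∀ θ : ℝ, expSeries f (t + θ * Complex.I) * (Complex.exp ((-n : ℤ) *
        (t + θ * Complex.I)) * (expSeries f (t + θ * Complex.I))⁻¹) =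
        Complex.exp ((-n : ℤ) * (t + θ * Complex.I)) := fun θ => by
      have := h0 θ
      field_simp
    simp only [h1, integral_exp_int_mul] at hs
    have hs' := hs.mul_left ((2 * π : ℂ)⁻¹)
    have h2 : (2 * π : ℂ)⁻¹ * (if -n = 0 then (2 * π : ℂ) else 0) = if n = 0 then 1 else 0 := by
      have hpi : (2 * π : ℂ) ≠ 0 := by simp [Real.pi_ne_zero]
      by_cases hn : n = 0
      · rw [if_pos (by omega), if_pos hn, inv_mul_cancel₀ hpi]
      · rw [if_neg (by omega), if_neg hn, mul_zero]
    rw [h2] at hs'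
    refine hs'.congr_fun' fun l => ?_
    rw [mul_left_comm]
    congr 3
    funext θ
    rw [← mul_assoc, ← Complex.exp_add, ← add_mul, ← Int.cast_add]
    congr 4
    ring

/-- A kernel `k` on `ℤ` that divides by the convolution with `f` on sequences that decay faster
than `exp (-r |l|)`, and maps such sequences to sequences that decay like `exp (-r |m|)`. -/
theorem exists_division_kernel {f : ℤ → ℂ} {L M : ℝ} (hM : 0 < M)
    (hf : ∀ n : ℤ, ‖f n‖ ≤ L * Real.exp (-M * |(n : ℝ)|)) (hf0 : f ≠ 0) {ε : ℝ} (hε : 0 < ε) :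
    ∃ (r A : ℝ) (k : ℤ → ℤ → ℂ), 0 < r ∧ r < ε ∧ r < M ∧ 0 < A ∧
      (∀ m l : ℤ, ‖k m l‖ ≤ A * Real.exp (r * (|(l : ℝ)| - |(m : ℝ)|))) ∧
      ∀ m l' : ℤ, HasSum (fun l => k m l * f (l' - l)) (if m = l' then 1 else 0) := by
  obtain ⟨r, hr, hrε, hrM, hr0⟩ := exists_radius hM hf hf0 hε
  have habs : |r| = r := abs_of_pos hr
  obtain ⟨A, a, hA, ha, has⟩ := exists_convolution_inverse hM hf (t := r) (by rwa [habs])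
    (hr0 r habs)
  obtain ⟨B, b, hB, hb, hbs⟩ := exists_convolution_inverse hM hf (t := -r) (by rwa [abs_neg, habs])
    (hr0 (-r) (by rwa [abs_neg]))
  -- The choice depends on the row `m` alone, so every row stays an exact inverse. For m ≥ 0 the
  -- inverse from the line Re x = -r is bounded by exp(r(l - m)), for m < 0 the one from Re x = r by
  -- exp(-r(l - m)); either way a factor exp(-r|m|) results.
  refine ⟨r, A + B, fun m l => if 0 ≤ m then b (l - m) else a (l - m), hr, hrε, by linarith,
    by positivity, fun m l => ?_, fun m l' => ?_⟩
  · dsimp only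
    split_ifs with hm
    · refine (hb _).trans ?_
      have hm' : |(m : ℝ)| = m := abs_of_nonneg (by exact_mod_cast hm)
      have : -(-r) * ((l - m : ℤ) : ℝ) ≤ r * (|(l : ℝ)| - |(m : ℝ)|) := by
        rw [hm', neg_neg]; push_cast
        gcongr
        exact le_abs_self _
      gcongr
      linarith
    · refine (ha _).trans ?_
      have hm' : |(m : ℝ)| = -m := abs_of_neg (by exact_mod_cast not_le.mp hm)
      have : -r * ((l - m : ℤ) : ℝ) ≤ r * (|(l : ℝ)| - |(m : ℝ)|) := by
        rw [hm']; push_cast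
        have := mul_le_mul_of_nonneg_left (neg_abs_le (l : ℝ)) hr.le
        linarith
      gcongr
      linarith
  · have key : ∀ c : ℤ → ℂ, (∀ n : ℤ, HasSum (fun l : ℤ => f l * c (n - l)) (if n = 0 then 1 else 0))
        → HasSum (fun l => c (l - m) * f (l' - l)) (if m = l' then 1 else 0) := by
      intro c hc
      have h := ((Equiv.subLeft l').hasSum_iff).mpr (hc (l' - m))
      simp only [sub_eq_zero, eq_comm (a := l')] at h
      refine h.congr_fun' fun l => ?_
      simp only [Function.comp_apply, Equiv.subLeft_apply]
      rw [mul_comm, sub_sub_sub_cancel_left]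
    by_cases hm : 0 ≤ m
    · simpa only [hm, if_true] using key b hbs
    · simpa only [hm, if_false] using key a has

end LatticeSUSY

/-! ### Estimates for local coefficients -/

namespace LatticeSUSY

open Real Set Filter Topology Function

section TILC

variable {I : ℕ}

/-- The sum of the distances of the sites from the first one. -/
noncomputable def spread (m : Fin (I + 1) → ℤ) : ℝ := ∑ i, |(m 0 : ℝ) - m i|

lemma spread_nonneg (m : Fin (I + 1) → ℤ) : 0 ≤ spread m :=
  Finset.sum_nonneg fun _ _ => abs_nonneg _

lemma abs_sub_le_spread (m : Fin (I + 1) → ℤ) (i : Fin (I + 1)) :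
    |(m 0 : ℝ) - m i| ≤ spread m :=
  Finset.single_le_sum (f := fun i => |(m 0 : ℝ) - m i|) (fun _ _ => abs_nonneg _)
    (Finset.mem_univ i)

/-- Decay in the sum of the distances is equivalent to decay in each of them, since the sum is at
most `I + 1` times the largest. The sum is easier to control when a single site moves. -/
lemma isTILC_iff {C : (Fin (I + 1) → ℤ) → ℂ} :
    IsTILC C ↔ (∀ m : Fin (I + 1) → ℤ, C (fun i => m i + 1) = C m) ∧
      ∃ L > (0 : ℝ), ∃ M > (0 : ℝ), ∀ m, ‖C m‖ ≤ L * Real.exp (-M * spread m) := by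
  refine and_congr_right fun _ => ⟨?_, ?_⟩
  · rintro ⟨L, hL, M, hM, h⟩
    refine ⟨L, hL, M / (I + 1), by positivity, fun m => ?_⟩
    obtain ⟨i, -, hi⟩ := Finset.exists_max_image Finset.univ (fun i => |(m 0 : ℝ) - m i|)
      ⟨0, Finset.mem_univ _⟩
    refine (h m i).le.trans ?_
    have h1 : spread m ≤ (I + 1) * |(m 0 : ℝ) - m i| := by
      refine (Finset.sum_le_card_nsmul Finset.univ _ _ fun j hj => hi j hj).trans_eq ?_
      simp
    have h2 : M / (I + 1) * spread m ≤ M * |(m 0 : ℝ) - m i| := by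
      rw [div_mul_eq_mul_div, div_le_iff₀ (by positivity), mul_assoc, mul_comm _ ((I : ℝ) + 1)]
      gcongr
    refine mul_le_mul_of_nonneg_left (Real.exp_le_exp.mpr ?_) (by positivity)
    push_cast
    linarith
  · rintro ⟨L, hL, M, hM, h⟩
    refine ⟨2 * L, by positivity, M, hM, fun m i => (h m).trans_lt ?_⟩
    have h1 := abs_sub_le_spread m i
    have h2 := mul_le_mul_of_nonneg_left h1 hM.le
    calc L * Real.exp (-M * spread m) ≤ L * Real.exp (-M * (|m 0 - m i| : ℤ)) := by
          refine mul_le_mul_of_nonneg_left (Real.exp_le_exp.mpr ?_) (by positivity)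
          push_cast
          linarith
      _ < _ := by
          have := Real.exp_pos (-M * (|m 0 - m i| : ℤ))
          nlinarith [mul_pos hL this]

lemma IsTILC.exists_bound {C : (Fin (I + 1) → ℤ) → ℂ} (hC : IsTILC C) :
    ∃ B > 0, ∀ m, ‖C m‖ ≤ B := by
  obtain ⟨-, L, hL, M, hM, h⟩ := isTILC_iff.mp hC
  refine ⟨L, hL, fun m => (h m).trans ?_⟩
  have : Real.exp (-M * spread m) ≤ 1 := by
    rw [Real.exp_le_one_iff]
    have := mul_nonneg hM.le (spread_nonneg m)
    linarith
  nlinarith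

lemma isTILC_zero : IsTILC (0 : (Fin (I + 1) → ℤ) → ℂ) :=
  isTILC_iff.mpr ⟨fun _ => rfl, 1, one_pos, 1, one_pos, fun m => by simp; positivity⟩

lemma IsTILC.add {C E : (Fin (I + 1) → ℤ) → ℂ} (hC : IsTILC C) (hE : IsTILC E) :
    IsTILC (C + E) := by
  obtain ⟨h1, L, hL, M, hM, h⟩ := isTILC_iff.mp hC
  obtain ⟨h1', L', hL', M', hM', h'⟩ := isTILC_iff.mp hE
  refine isTILC_iff.mpr ⟨fun m => by simp [h1, h1'], L + L', by positivity, min M M',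
    lt_min hM hM', fun m => ?_⟩
  have hs := spread_nonneg m
  calc ‖C m + E m‖ ≤ L * Real.exp (-M * spread m) + L' * Real.exp (-M' * spread m) :=
        (norm_add_le _ _).trans (add_le_add (h m) (h' m))
    _ ≤ L * Real.exp (-min M M' * spread m) + L' * Real.exp (-min M M' * spread m) := by
        gcongr
        · exact min_le_left _ _
        · exact min_le_right _ _
    _ = _ := by ring

lemma IsTILC.const_mul {C : (Fin (I + 1) → ℤ) → ℂ} (hC : IsTILC C) (c : ℂ) :
    IsTILC (c • C) := by
  obtain ⟨h1, L, hL, M, hM, h⟩ := isTILC_iff.mp hC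
  refine isTILC_iff.mpr ⟨fun m => by simp [h1], (‖c‖ + 1) * L, by positivity, M, hM, fun m => ?_⟩
  rw [Pi.smul_apply, smul_eq_mul, norm_mul, mul_assoc]
  gcongr
  · linarith
  · exact h m

/-- The translationally invariant local coefficients. -/
def tilc (I : ℕ) : Submodule ℂ ((Fin (I + 1) → ℤ) → ℂ) where
  carrier := {C | IsTILC C}
  zero_mem' := isTILC_zero
  add_mem' := IsTILC.add
  smul_mem' c _ h := IsTILC.const_mul h c

/-- A permutation changes the reference site; the triangle inequality through the new one costs a
factor `I + 2` in the rate. -/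
lemma IsTILC.comp_perm {C : (Fin (I + 1) → ℤ) → ℂ} (hC : IsTILC C)
    (σ : Equiv.Perm (Fin (I + 1))) : IsTILC fun m => C (m ∘ σ) := by
  obtain ⟨h1, L, hL, M, hM, h⟩ := isTILC_iff.mp hC
  refine isTILC_iff.mpr ⟨fun m => h1 (m ∘ σ), L, hL, M / (I + 2), by positivity, fun m => ?_⟩
  refine (h _).trans ?_
  have h2 : spread m ≤ (I + 2) * spread (m ∘ σ) := by
    have h3 : ∀ i, |(m 0 : ℝ) - m i| ≤ spread (m ∘ σ) + |(m (σ 0) : ℝ) - m i| := fun i => by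
      have h4 := abs_sub_le_spread (m ∘ σ) (σ.symm 0)
      simp only [comp_apply, Equiv.apply_symm_apply] at h4
      rw [abs_sub_comm] at h4
      exact (abs_sub_le _ (m (σ 0) : ℝ) _).trans (add_le_add_left h4 _)
    have h5 : ∑ i, |(m (σ 0) : ℝ) - m i| = spread (m ∘ σ) :=
      (Equiv.sum_comp σ fun i => |(m (σ 0) : ℝ) - m i|).symm
    calc spread m ≤ ∑ i, (spread (m ∘ σ) + |(m (σ 0) : ℝ) - m i|) :=
          Finset.sum_le_sum fun i _ => h3 i
      _ = _ := by
          rw [Finset.sum_add_distrib, h5]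
          simp
          ring
  have h6 : M / (I + 2) * spread m ≤ M * spread (m ∘ σ) := by
    rw [div_mul_eq_mul_div, div_le_iff₀ (by positivity), mul_assoc, mul_comm _ ((I : ℝ) + 2)]
    gcongr
  refine mul_le_mul_of_nonneg_left (Real.exp_le_exp.mpr ?_) (by positivity)
  linarith

lemma spread_le_spread_update (m : Fin (I + 1) → ℤ) (j : Fin (I + 1)) (l : ℤ) :
    spread m ≤ spread (update m j l) + (I + 1) * |(l : ℝ) - m j| := by
  have h : ∀ i, |(m 0 : ℝ) - m i| ≤
      |((update m j l) 0 : ℝ) - (update m j l) i| + |(l : ℝ) - m j| := by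
    intro i
    by_cases h0 : j = 0
    · subst h0
      by_cases hi : i = 0
      · subst hi; simp
      · rw [update_self, update_of_ne hi, add_comm (|_|), abs_sub_comm (l : ℝ) (m 0)]
        exact abs_sub_le _ _ _
    · rw [update_of_ne (Ne.symm h0)]
      by_cases hi : i = j
      · subst hi
        rw [update_self]
        exact abs_sub_le _ _ _
      · rw [update_of_ne hi]
        linarith [abs_nonneg ((l : ℝ) - m j)]
  refine (Finset.sum_le_sum fun i _ => h i).trans_eq ?_
  rw [Finset.sum_add_distrib]
  simp [spread]

/-- An exact formula holds because the reference site stays fixed and only one distance changes. -/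
lemma spread_update_of_ne_zero (m : Fin (I + 1) → ℤ) {j : Fin (I + 1)} (hj : j ≠ 0) (l : ℤ) :
    spread (update m j l) = spread m + |(m 0 : ℝ) - l| - |(m 0 : ℝ) - m j| := by
  unfold spread
  rw [← Finset.add_sum_erase _ _ (Finset.mem_univ j),
    ← Finset.add_sum_erase (a := j) _ (fun i => |(m 0 : ℝ) - m i|) (Finset.mem_univ j),
    update_self, update_of_ne (Ne.symm hj)]
  have : ∑ x ∈ Finset.univ.erase j, |(m 0 : ℝ) - (update m j l) x| =
      ∑ x ∈ Finset.univ.erase j, |(m 0 : ℝ) - m x| :=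
    Finset.sum_congr rfl fun i hi => by rw [update_of_ne (Finset.ne_of_mem_erase hi)]
  rw [this]
  ring

lemma update_add_one (m : Fin (I + 1) → ℤ) (j : Fin (I + 1)) (l : ℤ) :
    update (fun i => m i + 1) j (l + 1) = fun i => update m j l i + 1 := by
  funext i
  by_cases h : i = j
  · subst h; simp
  · simp [h]

/-- A translationally invariant matrix on `ℤ` with exponential off-diagonal decay. -/
structure IsLocalMatrix (K : ℤ → ℤ → ℂ) : Prop where
  shift : ∀ l m, K (l + 1) (m + 1) = K l m
  decay : ∃ L > (0 : ℝ), ∃ M > (0 : ℝ), ∀ l m : ℤ,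
    ‖K l m‖ ≤ L * Real.exp (-M * |((l - m : ℤ) : ℝ)|)

lemma summable_exp_sub {c : ℝ} (hc : 0 < c) (m : ℤ) :
    Summable fun l : ℤ => Real.exp (-c * |((l - m : ℤ) : ℝ)|) :=
  ((Equiv.subRight m).summable_iff (f := fun n : ℤ => Real.exp (-c * |(n : ℝ)|))).mpr
    (summable_exp_neg_mul_abs hc)

lemma tsum_exp_sub (c : ℝ) (m : ℤ) :
    ∑' l : ℤ, Real.exp (-c * |((l - m : ℤ) : ℝ)|) = ∑' n : ℤ, Real.exp (-c * |(n : ℝ)|) :=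
  (Equiv.subRight m).tsum_eq fun n : ℤ => Real.exp (-c * |(n : ℝ)|)

lemma IsLocalMatrix.summable_norm {K : ℤ → ℤ → ℂ} (hK : IsLocalMatrix K) (m : ℤ) :
    Summable fun l => ‖K l m‖ := by
  obtain ⟨L, hL, M, hM, h⟩ := hK.decay
  exact .of_nonneg_of_le (fun _ => norm_nonneg _) (fun l => h l m)
    ((summable_exp_sub hM m).mul_left L)

lemma IsLocalMatrix.summable_mul {K : ℤ → ℤ → ℂ} (hK : IsLocalMatrix K) {C : (Fin (I + 1) → ℤ) → ℂ}
    (hC : IsTILC C) (m : ℤ) (x : ℤ → Fin (I + 1) → ℤ) : Summable fun l => K l m * C (x l) := by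
  obtain ⟨B, hB, h⟩ := hC.exists_bound
  refine .of_norm_bounded ((hK.summable_norm m).mul_right B) fun l => ?_
  rw [norm_mul]
  gcongr
  exact h _

lemma IsLocalMatrix.isTILC {K : ℤ → ℤ → ℂ} (hK : IsLocalMatrix K) {C : (Fin (I + 1) → ℤ) → ℂ}
    (hC : IsTILC C) (j : Fin (I + 1)) :
    IsTILC fun m => ∑' l, K l (m j) * C (update m j l) := by
  obtain ⟨L, hL, M, hM, h⟩ := hK.decay
  obtain ⟨h1, L', hL', M', hM', h'⟩ := isTILC_iff.mp hC
  set X := ∑' n : ℤ, Real.exp (-(M / 2) * |(n : ℝ)|)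
  -- Moving one site by d changes the spread by at most (I + 1) d. Half of the decay of `K` pays for
  -- this, the other half makes the sum over `l` converge.
  set M₁ := min M' (M / (2 * (I + 1))) with hM₁
  have hM₁0 : 0 < M₁ := lt_min hM' (by positivity)
  have hX : 0 ≤ X := tsum_nonneg fun _ => (Real.exp_pos _).le
  refine isTILC_iff.mpr ⟨fun m => ?_, L * L' * X + 1, by positivity, M₁, hM₁0, fun m => ?_⟩
  · dsimp only
    rw [← (Equiv.addRight (1 : ℤ)).tsum_eq]
    refine tsum_congr fun l => ?_
    rw [Equiv.coe_addRight, update_add_one, h1, hK.shift]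
  · have key : ∀ l, ‖K l (m j) * C (update m j l)‖ ≤
        L * L' * Real.exp (-M₁ * spread m) * Real.exp (-(M / 2) * |((l - m j : ℤ) : ℝ)|) := by
      intro l
      rw [norm_mul]
      refine (mul_le_mul (h l (m j)) (h' _) (norm_nonneg _) (by positivity)).trans ?_
      rw [mul_mul_mul_comm, mul_assoc (L * L'), ← Real.exp_add, ← Real.exp_add]
      refine mul_le_mul_of_nonneg_left (Real.exp_le_exp.mpr ?_) (by positivity)
      have e1 := spread_le_spread_update m j l
      have e2 : M₁ ≤ M' := min_le_left _ _
      have e3 : M₁ * (I + 1) ≤ M / 2 := by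
        have : M₁ ≤ M / (2 * (I + 1)) := min_le_right _ _
        calc M₁ * (I + 1) ≤ M / (2 * (I + 1)) * (I + 1) := by gcongr
          _ = M / 2 := by field_simp
      push_cast
      have e4 := mul_le_mul_of_nonneg_left e1 hM₁0.le
      have e5 := mul_le_mul_of_nonneg_right e2 (spread_nonneg (update m j l))
      have e6 := mul_le_mul_of_nonneg_right e3 (abs_nonneg ((l : ℝ) - m j))
      nlinarith
    have hs := (summable_exp_sub (half_pos hM) (m j)).mul_left
      (L * L' * Real.exp (-M₁ * spread m))
    refine (tsum_of_norm_bounded hs.hasSum key).trans ?_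
    rw [tsum_mul_left, tsum_exp_sub]
    have := Real.exp_pos (-M₁ * spread m)
    nlinarith

/-- The growth of rate `r` of the kernel in its source variable is beaten by the faster decay of
`C`, and its decay in the target variable survives. The rate drops to `r`, so further divisions need
a smaller one. -/
lemma isTILC_division {r A : ℝ} (hr : 0 < r) (hA : 0 < A) {k : ℤ → ℤ → ℂ}
    (hk : ∀ m l : ℤ, ‖k m l‖ ≤ A * Real.exp (r * (|(l : ℝ)| - |(m : ℝ)|)))
    {C : (Fin (I + 1) → ℤ) → ℂ} (hC : ∀ m : Fin (I + 1) → ℤ, C (fun i => m i + 1) = C m)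
    {L M : ℝ} (hL : 0 < L) (hrM : r < M) (hb : ∀ m, ‖C m‖ ≤ L * Real.exp (-M * spread m))
    {j : Fin (I + 1)} (hj : j ≠ 0) :
    IsTILC fun m => ∑' l, k (m j - m 0) (l - m 0) * C (update m j l) := by
  set X := ∑' n : ℤ, Real.exp (-(M - r) * |(n : ℝ)|)
  have hX : 0 ≤ X := tsum_nonneg fun _ => (Real.exp_pos _).le
  refine isTILC_iff.mpr ⟨fun m => ?_, A * L * X + 1, by positivity, r, hr, fun m => ?_⟩
  · dsimp only
    rw [← (Equiv.addRight (1 : ℤ)).tsum_eq]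
    refine tsum_congr fun l => ?_
    rw [Equiv.coe_addRight, update_add_one, hC, add_sub_add_right_eq_sub,
      add_sub_add_right_eq_sub]
  · have key : ∀ l, ‖k (m j - m 0) (l - m 0) * C (update m j l)‖ ≤
        A * L * Real.exp (-r * spread m) * Real.exp (-(M - r) * |((l - m 0 : ℤ) : ℝ)|) := by
      intro l
      rw [norm_mul]
      refine (mul_le_mul (hk _ _) (hb _) (norm_nonneg _) (by positivity)).trans ?_
      rw [mul_mul_mul_comm, mul_assoc (A * L), ← Real.exp_add, ← Real.exp_add]
      refine mul_le_mul_of_nonneg_left (Real.exp_le_exp.mpr ?_) (by positivity)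
      have e1 := spread_update_of_ne_zero m hj l
      have e2 := abs_sub_le_spread m j
      rw [e1, abs_sub_comm (m 0 : ℝ) l]
      push_cast
      rw [abs_sub_comm (m 0 : ℝ) (m j)] at *
      have e3 := mul_le_mul_of_nonneg_left e2 (sub_nonneg.mpr hrM.le)
      nlinarith [abs_nonneg ((l : ℝ) - m 0)]
    have hs := (summable_exp_sub (sub_pos.mpr hrM) (m 0)).mul_left
      (A * L * Real.exp (-r * spread m))
    refine (tsum_of_norm_bounded hs.hasSum key).trans ?_
    rw [tsum_mul_left, tsum_exp_sub]
    have := Real.exp_pos (-r * spread m)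
    nlinarith

lemma isLocalMatrix_zero : IsLocalMatrix fun _ _ => 0 :=
  ⟨fun _ _ => rfl, 1, one_pos, 1, one_pos, fun _ _ => by simp; positivity⟩

lemma isLocalMatrix_kronecker : IsLocalMatrix kronecker := by
  refine ⟨fun l m => by simp [kronecker], 1, one_pos, 1, one_pos, fun l m => ?_⟩
  unfold kronecker
  split_ifs with h
  · simp [h]
  · simp; positivity

lemma IsLocalMatrix.const_mul {K : ℤ → ℤ → ℂ} (hK : IsLocalMatrix K) (c : ℂ) :
    IsLocalMatrix fun l m => c * K l m := by
  obtain ⟨L, hL, M, hM, h⟩ := hK.decay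
  refine ⟨fun l m => by rw [hK.shift], (‖c‖ + 1) * L, by positivity, M, hM, fun l m => ?_⟩
  rw [norm_mul, mul_assoc]
  gcongr
  · linarith
  · exact h l m

lemma IsDifferenceOperator.isLocalMatrix {D : ℤ → ℤ → ℂ} (hD : IsDifferenceOperator D) :
    IsLocalMatrix D := by
  obtain ⟨h1, L, hL, M, hM, h⟩ := hD.tilc
  refine ⟨fun l m => ?_, L, hL, M, hM, fun l m => ?_⟩
  · simpa using h1 ![l, m]
  · simpa using (h ![l, m] 1).le

end TILC

end LatticeSUSY

/-! ### Odd derivations factor by factor -/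

namespace LatticeSUSY

open Function

/-- The coefficients of the monomials of order `I + 1`. -/
abbrev Coeff (I : ℕ) : Type := (Fin (I + 1) → Species) → (Fin (I + 1) → ℤ) → ℂ

/-- The values of a linear map on the field variables, `X_{a, l} ↦ ∑_b ∑_n A a b l n • X_{b, n}`. -/
abbrev Kernel : Type := Species → Species → ℤ → ℤ → ℂ

section Slot

variable {I : ℕ}

/-- The coefficients of order `I + 1` that are local. -/
def localCoeff (I : ℕ) : Submodule ℂ (Coeff I) where
  carrier := {C | ∀ w, IsTILC (C w)}
  zero_mem' _ := isTILC_zero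
  add_mem' h h' w := (h w).add (h' w)
  smul_mem' c _ h w := (h w).const_mul c

/-- Multiplication by a function of the word. -/
def wordMul (θ : (Fin (I + 1) → Species) → ℂ) (C : Coeff I) : Coeff I := fun w m => θ w * C w m

lemma wordMul_mem (θ : (Fin (I + 1) → Species) → ℂ) {C : Coeff I} (hC : C ∈ localCoeff I) :
    wordMul θ C ∈ localCoeff I := fun w => (hC w).const_mul (θ w)

/-- A kernel that is local and exchanges bosons and fermions. -/
structure IsLocalKernel (A : Kernel) : Prop where
  isLocalMatrix : ∀ a b, IsLocalMatrix (A a b)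
  odd : ∀ a b l m, A a b l m ≠ 0 → isOdd a ≠ isOdd b

/-- The action of an odd derivation on the `j`-th factor. -/
noncomputable def slot (A : Kernel) (j : Fin (I + 1)) (C : Coeff I) : Coeff I := fun w m =>
  passSign w j * ∑ a : Species, ∑' l : ℤ, A a (w j) l (m j) * C (update w j a) (update m j l)

/-- The action of an odd derivation on the factors with index in `J`. -/
noncomputable def derivOn (J : Finset (Fin (I + 1))) (A : Kernel) (C : Coeff I) : Coeff I :=
  ∑ j ∈ J, slot A j C

lemma derivOn_apply (J : Finset (Fin (I + 1))) (A : Kernel) (C : Coeff I)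
    (w : Fin (I + 1) → Species) (m : Fin (I + 1) → ℤ) :
    derivOn J A C w m = ∑ j ∈ J, slot A j C w m := by
  simp [derivOn, Finset.sum_apply]

lemma oddDerivation_eq_derivOn (A : Kernel) (S : Functional) (I : ℕ) :
    oddDerivation A S I = derivOn Finset.univ A (S I) := by
  funext w m
  rw [derivOn_apply]
  rfl

lemma passSign_mul_self (w : Fin (I + 1) → Species) (j : Fin (I + 1)) :
    passSign w j * passSign w j = 1 := by
  unfold passSign
  rw [← Finset.prod_mul_distrib]
  exact Finset.prod_eq_one fun i _ => by split_ifs <;> norm_num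

lemma passSign_update_self (w : Fin (I + 1) → Species) (j : Fin (I + 1)) (a : Species) :
    passSign (update w j a) j = passSign w j := by
  unfold passSign
  refine Finset.prod_congr rfl fun i hi => ?_
  rw [update_of_ne (Finset.mem_filter.mp hi).2.ne]

/-- Changing the parity of the letter at `i` flips the sign exactly for operators that pass over it.
This is the source of all anticommutation below. -/
lemma passSign_update_of_ne {w : Fin (I + 1) → Species} {i : Fin (I + 1)} {a : Species}
    (ha : isOdd a ≠ isOdd (w i)) (j : Fin (I + 1)) :
    passSign (update w i a) j = (if i < j then -1 else 1) * passSign w j := by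
  unfold passSign
  have hrest : ∀ k, k ≠ i → (if isOdd (update w i a k) = true then (-1 : ℂ) else 1) =
      if isOdd (w k) = true then -1 else 1 := fun k hk => by rw [update_of_ne hk]
  split_ifs with h
  · have hm : i ∈ Finset.univ.filter (fun k => k < j) := by simp [h]
    rw [← Finset.mul_prod_erase _ _ hm,
      ← Finset.mul_prod_erase _ (fun k => if isOdd (w k) = true then (-1 : ℂ) else 1) hm,
      update_self, ← mul_assoc]
    congr 1
    · revert ha
      cases isOdd a <;> cases isOdd (w i) <;> simp
    · exact Finset.prod_congr rfl fun k hk => hrest k (Finset.ne_of_mem_erase hk)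
  · rw [one_mul]
    refine Finset.prod_congr rfl fun k hk => hrest k ?_
    rintro rfl
    exact h (Finset.mem_filter.mp hk).2

lemma slot_mem {A : Kernel} (hA : IsLocalKernel A) (j : Fin (I + 1)) {C : Coeff I}
    (hC : C ∈ localCoeff I) : slot A j C ∈ localCoeff I := by
  intro w
  have h : ∑ a : Species, (fun m : Fin (I + 1) → ℤ =>
      ∑' l : ℤ, A a (w j) l (m j) * C (update w j a) (update m j l)) ∈ tilc I :=
    Submodule.sum_mem _ fun a _ => (hA.isLocalMatrix a (w j)).isTILC (hC _) j
  have h' := (tilc I).smul_mem (passSign w j) h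
  convert! h' using 1

lemma derivOn_mem {A : Kernel} (hA : IsLocalKernel A) (J : Finset (Fin (I + 1))) {C : Coeff I}
    (hC : C ∈ localCoeff I) : derivOn J A C ∈ localCoeff I :=
  Submodule.sum_mem _ fun j _ => slot_mem hA j hC

lemma slot_zero (A : Kernel) (j : Fin (I + 1)) : slot A j (0 : Coeff I) = 0 := by
  funext w m
  simp [slot]

lemma slot_add {A : Kernel} (hA : IsLocalKernel A) (j : Fin (I + 1)) {C E : Coeff I}
    (hC : C ∈ localCoeff I) (hE : E ∈ localCoeff I) :
    slot A j (C + E) = slot A j C + slot A j E := by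
  funext w m
  simp only [slot, Pi.add_apply]
  rw [← mul_add, ← Finset.sum_add_distrib]
  congr 1
  refine Finset.sum_congr rfl fun a _ => ?_
  rw [← Summable.tsum_add ((hA.isLocalMatrix _ _).summable_mul (hC _) _ _)
    ((hA.isLocalMatrix _ _).summable_mul (hE _) _ _)]
  exact tsum_congr fun l => mul_add _ _ _

lemma slot_smul (A : Kernel) (j : Fin (I + 1)) (c : ℂ) (C : Coeff I) :
    slot A j (c • C) = c • slot A j C := by
  funext w m
  simp only [slot, Pi.smul_apply, smul_eq_mul, mul_left_comm _ c, tsum_mul_left,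
    ← Finset.mul_sum]

lemma slot_sum {A : Kernel} (hA : IsLocalKernel A) (j : Fin (I + 1)) {ι : Type*} (s : Finset ι)
    {C : ι → Coeff I} (hC : ∀ i ∈ s, C i ∈ localCoeff I) :
    slot A j (∑ i ∈ s, C i) = ∑ i ∈ s, slot A j (C i) := by
  classical
  induction s using Finset.induction_on with
  | empty => simp [slot_zero]
  | insert i s hi ih =>
    rw [Finset.sum_insert hi, Finset.sum_insert hi,
      slot_add hA j (hC i (Finset.mem_insert_self _ _))
        (Submodule.sum_mem _ fun k hk => hC k (Finset.mem_insert_of_mem hk)),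
      ih fun k hk => hC k (Finset.mem_insert_of_mem hk)]

lemma derivOn_add {A : Kernel} (hA : IsLocalKernel A) (J : Finset (Fin (I + 1))) {C E : Coeff I}
    (hC : C ∈ localCoeff I) (hE : E ∈ localCoeff I) :
    derivOn J A (C + E) = derivOn J A C + derivOn J A E := by
  simp only [derivOn, slot_add hA _ hC hE, Finset.sum_add_distrib]

lemma derivOn_smul (A : Kernel) (J : Finset (Fin (I + 1))) (c : ℂ) (C : Coeff I) :
    derivOn J A (c • C) = c • derivOn J A C := by
  simp only [derivOn, slot_smul, Finset.smul_sum]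

lemma derivOn_zero (A : Kernel) (J : Finset (Fin (I + 1))) : derivOn J A (0 : Coeff I) = 0 := by
  simp [derivOn, slot_zero]

lemma derivOn_sub {A : Kernel} (hA : IsLocalKernel A) (J : Finset (Fin (I + 1))) {C E : Coeff I}
    (hC : C ∈ localCoeff I) (hE : E ∈ localCoeff I) :
    derivOn J A (C - E) = derivOn J A C - derivOn J A E := by
  have h : C - E = C + (-1 : ℂ) • E := by simp [sub_eq_add_neg]
  rw [h, derivOn_add hA J hC (Submodule.smul_mem _ _ hE), derivOn_smul]
  simp [sub_eq_add_neg]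

lemma derivOn_sum {A : Kernel} (hA : IsLocalKernel A) (J : Finset (Fin (I + 1))) {ι : Type*}
    (s : Finset ι) {C : ι → Coeff I} (hC : ∀ i ∈ s, C i ∈ localCoeff I) :
    derivOn J A (∑ i ∈ s, C i) = ∑ i ∈ s, derivOn J A (C i) := by
  simp only [derivOn]
  rw [Finset.sum_comm]
  exact Finset.sum_congr rfl fun j _ => slot_sum hA j s hC

lemma slot_wordMul {A : Kernel} {j : Fin (I + 1)} {θ θ' : (Fin (I + 1) → Species) → ℂ}
    {C : Coeff I} {w : Fin (I + 1) → Species}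
    (h : ∀ a l m, A a (w j) l m ≠ 0 → (∃ m, C (update w j a) m ≠ 0) → θ (update w j a) = θ' w)
    (m : Fin (I + 1) → ℤ) :
    slot A j (wordMul θ C) w m = θ' w * slot A j C w m := by
  simp only [slot, wordMul]
  rw [mul_left_comm]
  congr 1
  rw [Finset.mul_sum]
  refine Finset.sum_congr rfl fun a _ => ?_
  rw [← tsum_mul_left]
  congr 1
  funext l
  by_cases hA : A a (w j) l (m j) = 0
  · simp [hA]
  by_cases hC : C (update w j a) (update m j l) = 0
  · simp [hC]
  rw [h a _ _ hA ⟨_, hC⟩]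
  ring

/-- Weights and projections depending on the word pass through a derivation once they match along
the substitutions that actually contribute. -/
lemma derivOn_wordMul {A : Kernel} {J : Finset (Fin (I + 1))}
    {θ θ' : (Fin (I + 1) → Species) → ℂ} {C : Coeff I}
    (h : ∀ w, ∀ j ∈ J, ∀ a l m, A a (w j) l m ≠ 0 → (∃ m, C (update w j a) m ≠ 0) →
      θ (update w j a) = θ' w) :
    derivOn J A (wordMul θ C) = wordMul θ' (derivOn J A C) := by
  funext w m
  simp only [wordMul, derivOn_apply]
  rw [Finset.mul_sum]
  exact Finset.sum_congr rfl fun j hj => slot_wordMul (h w j hj) m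

lemma slot_congr {A B : Kernel} {j : Fin (I + 1)} {C : Coeff I} {w : Fin (I + 1) → Species}
    (h : ∀ a, (∃ m, C (update w j a) m ≠ 0) → A a (w j) = B a (w j)) (m : Fin (I + 1) → ℤ) :
    slot A j C w m = slot B j C w m := by
  simp only [slot]
  congr 1
  refine Finset.sum_congr rfl fun a _ => ?_
  congr 1
  funext l
  by_cases hC : C (update w j a) (update m j l) = 0
  · simp [hC]
  rw [h a ⟨_, hC⟩]

lemma exists_of_slot_ne_zero {A : Kernel} {j : Fin (I + 1)} {C : Coeff I}
    {w : Fin (I + 1) → Species} {m : Fin (I + 1) → ℤ} (h : slot A j C w m ≠ 0) :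
    ∃ a l, A a (w j) l (m j) ≠ 0 ∧ C (update w j a) (update m j l) ≠ 0 := by
  by_contra! hcon
  apply h
  simp only [slot]
  have h0 : ∀ a l, A a (w j) l (m j) * C (update w j a) (update m j l) = 0 := fun a l => by
    by_cases hA : A a (w j) l (m j) = 0
    · simp [hA]
    · rw [hcon a l hA, mul_zero]
  simp [h0]

lemma exists_of_derivOn_ne_zero {A : Kernel} {J : Finset (Fin (I + 1))} {C : Coeff I}
    {w : Fin (I + 1) → Species} {m : Fin (I + 1) → ℤ} (h : derivOn J A C w m ≠ 0) :
    ∃ j ∈ J, ∃ a l, A a (w j) l (m j) ≠ 0 ∧ C (update w j a) (update m j l) ≠ 0 := by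
  rw [derivOn_apply] at h
  obtain ⟨j, hj, h⟩ := Finset.exists_ne_zero_of_sum_ne_zero h
  exact ⟨j, hj, exists_of_slot_ne_zero h⟩

lemma slot_slot_self (A B : Kernel) (j : Fin (I + 1)) (C : Coeff I)
    (w : Fin (I + 1) → Species) (m : Fin (I + 1) → ℤ) :
    slot A j (slot B j C) w m = ∑ a : Species, ∑' l : ℤ, A a (w j) l (m j) *
      ∑ b : Species, ∑' l' : ℤ, B b a l' l * C (update w j b) (update m j l') := by
  simp only [slot, passSign_update_self, update_self, update_idem, mul_left_comm _ (passSign w j),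
    tsum_mul_left, ← Finset.mul_sum]
  rw [← mul_assoc, passSign_mul_self, one_mul]

lemma slot_slot_of_ne {A B : Kernel} (hA : ∀ a b l m, A a b l m ≠ 0 → isOdd a ≠ isOdd b)
    {i j : Fin (I + 1)} (hij : i ≠ j) {C : Coeff I} {w : Fin (I + 1) → Species}
    {m : Fin (I + 1) → ℤ}
    (hs : ∀ a b, Summable fun p : ℤ × ℤ => A a (w i) p.1 (m i) * (B b (w j) p.2 (m j) *
      C (update (update w i a) j b) (update (update m i p.1) j p.2))) :
    slot A i (slot B j C) w m = (if i < j then -1 else 1) * (passSign w i * passSign w j *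
      ∑ a : Species, ∑ b : Species, ∑' p : ℤ × ℤ, A a (w i) p.1 (m i) * (B b (w j) p.2 (m j) *
      C (update (update w i a) j b) (update (update m i p.1) j p.2))) := by
  have key : ∀ a : Species, ∑' l : ℤ, A a (w i) l (m i) *
      slot B j C (update w i a) (update m i l) = (if i < j then -1 else 1) * passSign w j *
      ∑ b : Species, ∑' p : ℤ × ℤ, A a (w i) p.1 (m i) * (B b (w j) p.2 (m j) *
      C (update (update w i a) j b) (update (update m i p.1) j p.2)) := by
    intro a
    have h1 : ∀ l : ℤ, A a (w i) l (m i) * slot B j C (update w i a) (update m i l) =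
        (if i < j then -1 else 1) * passSign w j * ∑ b : Species, ∑' l' : ℤ, A a (w i) l (m i) *
        (B b (w j) l' (m j) * C (update (update w i a) j b) (update (update m i l) j l')) := by
      intro l
      by_cases h0 : A a (w i) l (m i) = 0
      · simp [h0]
      · simp only [slot, passSign_update_of_ne (hA _ _ _ _ h0), update_of_ne hij.symm,
          tsum_mul_left, ← Finset.mul_sum]
        ring
    simp_rw [h1]
    rw [tsum_mul_left, Summable.tsum_finsetSum fun b _ => (hs a b).prod]
    congr 1
    exact Finset.sum_congr rfl fun b _ => ((hs a b).tsum_prod).symm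
  simp only [slot] at key ⊢
  simp only [key, ← Finset.mul_sum]
  ring

/-- Both orders give the same double sum over replacements at `i` and `j`, up to one Grassmann sign
from the left of the two positions. Summability is a hypothesis so that the division kernel, which
is not a local matrix, is covered too. -/
lemma slot_slot_swap {A B : Kernel} (hA : ∀ a b l m, A a b l m ≠ 0 → isOdd a ≠ isOdd b)
    (hB : ∀ a b l m, B a b l m ≠ 0 → isOdd a ≠ isOdd b)
    {i j : Fin (I + 1)} (hij : i ≠ j) {C : Coeff I} {w : Fin (I + 1) → Species}
    {m : Fin (I + 1) → ℤ}
    (hs : ∀ a b, Summable fun p : ℤ × ℤ => A a (w i) p.1 (m i) * (B b (w j) p.2 (m j) *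
      C (update (update w i a) j b) (update (update m i p.1) j p.2))) :
    slot A i (slot B j C) w m = -slot B j (slot A i C) w m := by
  have hcomm : ∀ a b (p : ℤ × ℤ), A a (w i) p.1 (m i) * (B b (w j) p.2 (m j) *
      C (update (update w i a) j b) (update (update m i p.1) j p.2)) =
      B b (w j) p.2 (m j) * (A a (w i) p.1 (m i) *
      C (update (update w j b) i a) (update (update m j p.2) i p.1)) := fun a b p => by
    rw [update_comm hij, update_comm hij, mul_left_comm]
  have hs' : ∀ b a, Summable fun p : ℤ × ℤ => B b (w j) p.1 (m j) * (A a (w i) p.2 (m i) *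
      C (update (update w j b) i a) (update (update m j p.1) i p.2)) := fun b a => by
    have := (Equiv.prodComm ℤ ℤ).summable_iff.mpr (hs a b)
    refine this.congr fun p => ?_
    simp only [comp_apply, hcomm]
    rfl
  rw [slot_slot_of_ne hA hij hs, slot_slot_of_ne hB hij.symm hs', Finset.sum_comm]
  have h1 : ∀ a b, ∑' p : ℤ × ℤ, A a (w i) p.1 (m i) * (B b (w j) p.2 (m j) *
      C (update (update w i a) j b) (update (update m i p.1) j p.2)) =
      ∑' p : ℤ × ℤ, B b (w j) p.1 (m j) * (A a (w i) p.2 (m i) *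
      C (update (update w j b) i a) (update (update m j p.1) i p.2)) := fun a b => by
    rw [← (Equiv.prodComm ℤ ℤ).tsum_eq]
    refine tsum_congr fun p => ?_
    rw [hcomm]
    rfl
  simp only [h1]
  rcases lt_or_gt_of_ne hij with h | h
  · rw [if_pos h, if_neg h.not_gt]
    ring
  · rw [if_neg h.not_gt, if_pos h]
    ring

lemma slot_anticomm {A B : Kernel} (hA : IsLocalKernel A) (hB : IsLocalKernel B)
    {i j : Fin (I + 1)} (hij : i ≠ j) {C : Coeff I} (hC : C ∈ localCoeff I) :
    slot A i (slot B j C) = -slot B j (slot A i C) := by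
  funext w m
  refine slot_slot_swap hA.odd hB.odd hij fun a b => ?_
  obtain ⟨K, hK, h⟩ := (hC (update (update w i a) j b)).exists_bound
  have h1 := ((hA.isLocalMatrix a (w i)).summable_norm (m i)).mul_of_nonneg
    (((hB.isLocalMatrix b (w j)).summable_norm (m j)).mul_right K) (fun _ => norm_nonneg _)
    (fun _ => by positivity)
  refine .of_norm_bounded h1 fun p => ?_
  rw [norm_mul, norm_mul]
  gcongr
  exact h _

/-- The off-diagonal terms cancel in pairs: the anticommutator of two odd derivations is an even
derivation, determined by its action on single letters. -/
theorem derivOn_anticomm {A B : Kernel} (hA : IsLocalKernel A) (hB : IsLocalKernel B)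
    (J : Finset (Fin (I + 1))) {C : Coeff I} (hC : C ∈ localCoeff I) :
    derivOn J A (derivOn J B C) + derivOn J B (derivOn J A C) =
      ∑ j ∈ J, (slot A j (slot B j C) + slot B j (slot A j C)) := by
  have h1 : derivOn J A (derivOn J B C) = ∑ i ∈ J, ∑ j ∈ J, slot A i (slot B j C) :=
    Finset.sum_congr rfl fun i _ => slot_sum hA i J fun j _ => slot_mem hB j hC
  have h2 : derivOn J B (derivOn J A C) = ∑ i ∈ J, ∑ j ∈ J, slot B j (slot A i C) := by
    rw [Finset.sum_comm]
    exact Finset.sum_congr rfl fun i _ => slot_sum hB i J fun j _ => slot_mem hA j hC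
  rw [h1, h2, ← Finset.sum_add_distrib]
  refine Finset.sum_congr rfl fun i hi => ?_
  rw [← Finset.sum_add_distrib, Finset.sum_eq_single_of_mem i hi]
  intro j _ hj
  rw [slot_anticomm hA hB hj.symm hC, neg_add_cancel]

end Slot

end LatticeSUSY

/-! ### Koszul differential and division in one factor -/

namespace LatticeSUSY

open Function

/-- The species on which the Koszul differential `χ ↦ ∇φ`, `F ↦ ∇χ̄` does not vanish. -/
def isUp : Species → Bool
  | (.chi, _) => true
  | (.aux, _) => true
  | (.phi, _) => false
  | (.chibar, _) => false

/-- `φ ↦ χ`, `χ̄ ↦ F` -/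
def raise : Species → Species
  | (.phi, s) => (.chi, s)
  | (.chibar, s) => (.aux, s)
  | x => x

/-- `χ ↦ φ`, `F ↦ χ̄` -/
def lower : Species → Species
  | (.chi, s) => (.phi, s)
  | (.aux, s) => (.chibar, s)
  | x => x

/-- The coefficients `α` of `χ ↦ α ∇φ` and `β` of `F ↦ β ∇χ̄`. -/
def koszulCoeff (α β : ℂ) : Species → ℂ
  | (.phi, _) => α
  | (.chi, _) => α
  | (.chibar, _) => β
  | (.aux, _) => β

lemma isUp_raise (b : Species) : isUp (raise b) = true := by rcases b with ⟨_ | _ | _ | _, _⟩ <;> rfl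
lemma isUp_lower (b : Species) : isUp (lower b) = false := by
  rcases b with ⟨_ | _ | _ | _, _⟩ <;> rfl
lemma snd_raise (b : Species) : (raise b).2 = b.2 := by rcases b with ⟨_ | _ | _ | _, _⟩ <;> rfl
lemma snd_lower (b : Species) : (lower b).2 = b.2 := by rcases b with ⟨_ | _ | _ | _, _⟩ <;> rfl
lemma lower_raise {b : Species} (h : isUp b = false) : lower (raise b) = b := by
  rcases b with ⟨_ | _ | _ | _, _⟩ <;> first | rfl | cases h
lemma raise_lower {b : Species} (h : isUp b = true) : raise (lower b) = b := by
  rcases b with ⟨_ | _ | _ | _, _⟩ <;> first | rfl | cases h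
lemma isOdd_raise {b : Species} (h : isUp b = false) : isOdd (raise b) ≠ isOdd b := by
  rcases b with ⟨_ | _ | _ | _, _⟩ <;> first | (simp [isOdd, raise]; done) | cases h
lemma isOdd_lower {b : Species} (h : isUp b = true) : isOdd (lower b) ≠ isOdd b := by
  rcases b with ⟨_ | _ | _ | _, _⟩ <;> first | (simp [isOdd, lower]; done) | cases h
lemma koszulCoeff_lower (α β : ℂ) (b : Species) :
    koszulCoeff α β (lower b) = koszulCoeff α β b := by
  rcases b with ⟨_ | _ | _ | _, _⟩ <;> rfl
lemma koszulCoeff_ne_zero {α β : ℂ} (hα : α ≠ 0) (hβ : β ≠ 0) (b : Species) :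
    koszulCoeff α β b ≠ 0 := by
  rcases b with ⟨_ | _ | _ | _, _⟩ <;> assumption

/-- The Koszul differential `χ_s ↦ α ∇φ_s`, `F_s ↦ β ∇χ̄_s`. -/
noncomputable def koszul (D : ℤ → ℤ → ℂ) (s : Sgn) (α β : ℂ) : Kernel := fun a b l m =>
  if a = raise b then if isUp b = false ∧ b.2 = s then koszulCoeff α β b * D l m else 0 else 0

/-- The division by `∇` with respect to the origin `c`, with `φ_s ↦ χ_s` and `χ̄_s ↦ F_s`. -/
noncomputable def divKernel (k : ℤ → ℤ → ℂ) (s : Sgn) (α β : ℂ) (c : ℤ) : Kernel := fun a b l m =>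
  if a = lower b then
    if isUp b = true ∧ b.2 = s then (koszulCoeff α β b)⁻¹ * k (m - c) (l - c) else 0 else 0

section Koszul

variable {I : ℕ} {D : ℤ → ℤ → ℂ} {s : Sgn} {α β : ℂ} {k : ℤ → ℤ → ℂ}

lemma isLocalKernel_koszul (hD : IsLocalMatrix D) (s : Sgn) (α β : ℂ) :
    IsLocalKernel (koszul D s α β) := by
  constructor
  · intro a b
    unfold koszul
    split_ifs
    · exact hD.const_mul _
    · exact isLocalMatrix_zero
    · exact isLocalMatrix_zero
  · intro a b l m h
    unfold koszul at h
    split_ifs at h with h1 h2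
    · exact h1 ▸ isOdd_raise h2.1
    · exact absurd rfl h
    · exact absurd rfl h

lemma divKernel_odd (k : ℤ → ℤ → ℂ) (s : Sgn) (α β : ℂ) (c : ℤ) (a b : Species) (l m : ℤ)
    (h : divKernel k s α β c a b l m ≠ 0) : isOdd a ≠ isOdd b := by
  unfold divKernel at h
  split_ifs at h with h1 h2
  · exact h1 ▸ isOdd_lower h2.1
  · exact absurd rfl h
  · exact absurd rfl h

lemma slot_koszul (j : Fin (I + 1)) (C : Coeff I) (w : Fin (I + 1) → Species)
    (m : Fin (I + 1) → ℤ) : slot (koszul D s α β) j C w m =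
      if isUp (w j) = false ∧ (w j).2 = s then passSign w j * (koszulCoeff α β (w j) *
        ∑' l, D l (m j) * C (update w j (raise (w j))) (update m j l)) else 0 := by
  simp only [slot, koszul]
  rw [Finset.sum_eq_single (raise (w j)) (fun a _ ha => by simp [ha])
    (fun h => absurd (Finset.mem_univ _) h)]
  simp only [if_true]
  split_ifs <;> simp [mul_assoc, tsum_mul_left]

/-- The division by `∇` in the `j`-th factor, with respect to the first site as origin. -/
noncomputable def divSlot (k : ℤ → ℤ → ℂ) (s : Sgn) (α β : ℂ) (j : Fin (I + 1)) (C : Coeff I) :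
    Coeff I := fun w m => slot (divKernel k s α β (m 0)) j C w m

lemma divSlot_apply (j : Fin (I + 1)) (C : Coeff I) (w : Fin (I + 1) → Species)
    (m : Fin (I + 1) → ℤ) : divSlot k s α β j C w m =
      if isUp (w j) = true ∧ (w j).2 = s then passSign w j * ((koszulCoeff α β (w j))⁻¹ *
        ∑' l, k (m j - m 0) (l - m 0) * C (update w j (lower (w j))) (update m j l)) else 0 := by
  simp only [divSlot, slot, divKernel]
  rw [Finset.sum_eq_single (lower (w j)) (fun a _ ha => by simp [ha])
    (fun h => absurd (Finset.mem_univ _) h)]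
  simp only [if_true]
  split_ifs <;> simp [mul_assoc, tsum_mul_left]

lemma slot_koszul_sq (j : Fin (I + 1)) (C : Coeff I) :
    slot (koszul D s α β) j (slot (koszul D s α β) j C) = 0 := by
  funext w m
  rw [slot_koszul]
  split_ifs
  · simp [slot_koszul, isUp_raise]
  · rfl

/-- Applied twice in the same factor it vanishes, since a lowered letter is annihilated; distinct
factors anticommute. -/
lemma derivOn_koszul_sq (hD : IsLocalMatrix D) (J : Finset (Fin (I + 1))) {C : Coeff I}
    (hC : C ∈ localCoeff I) :
    derivOn J (koszul D s α β) (derivOn J (koszul D s α β) C) = 0 := by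
  have hK := isLocalKernel_koszul hD s α β
  have h := derivOn_anticomm hK hK J hC
  simp only [slot_koszul_sq, add_zero, Finset.sum_const_zero] at h
  exact self_eq_neg.mp (eq_neg_of_add_eq_zero_left h)

/-- Exponential decay at a rate larger than `r`, uniformly in the word. -/
def DecaysFaster (r : ℝ) (C : Coeff I) : Prop :=
  ∃ L > (0 : ℝ), ∃ M > r, ∀ w m, ‖C w m‖ ≤ L * Real.exp (-M * spread m)

/-- There are finitely many words of a given order, so the slowest of their decay rates serves for
all. -/
lemma exists_decaysFaster {C : Coeff I} (hC : C ∈ localCoeff I) :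
    ∃ ε > 0, ∀ r < ε, DecaysFaster r C := by
  choose h1 L hL M hM h using fun w => isTILC_iff.mp (hC w)
  have : Nonempty (Fin (I + 1) → Species) := ⟨fun _ => (.phi, .plus)⟩
  obtain ⟨w₀, hw₀⟩ := Finite.exists_min M
  refine ⟨M w₀, hM w₀, fun r hr => ⟨∑ w, L w, Finset.sum_pos (fun w _ => hL w)
    Finset.univ_nonempty, M w₀, hr, fun w m => (h w m).trans ?_⟩⟩
  have h2 : L w ≤ ∑ w, L w := Finset.single_le_sum (fun w _ => (hL w).le) (Finset.mem_univ w)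
  have h3 := mul_le_mul_of_nonneg_right (hw₀ w) (spread_nonneg m)
  refine mul_le_mul h2 (Real.exp_le_exp.mpr (by linarith)) (Real.exp_pos _).le ?_
  exact (hL w).le.trans h2

/-- The properties of the kernel from `exists_division_kernel`. -/
structure IsDivisionKernel (D : ℤ → ℤ → ℂ) (k : ℤ → ℤ → ℂ) (r : ℝ) : Prop where
  pos : 0 < r
  bound : ∃ A > (0 : ℝ), ∀ m l : ℤ, ‖k m l‖ ≤ A * Real.exp (r * (|(l : ℝ)| - |(m : ℝ)|))
  decay : ∃ L > (0 : ℝ), ∃ M > r, ∀ l m : ℤ, ‖D l m‖ ≤ L * Real.exp (-M * |((l - m : ℤ) : ℝ)|)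
  hasSum : ∀ c m l' : ℤ, HasSum (fun l => k (m - c) (l - c) * D l' l) (if m = l' then 1 else 0)

/-- Translation invariance turns `D` into the convolution by `D n 0`, and the kernel is then shifted
to an arbitrary origin. -/
lemma exists_isDivisionKernel (hD : IsDifferenceOperator D) {ε : ℝ} (hε : 0 < ε) :
    ∃ r < ε, ∃ k, IsDivisionKernel D k r := by
  have hloc := hD.isLocalMatrix
  obtain ⟨L, hL, M, hM, h⟩ := hloc.decay
  have hshift : ∀ c l m : ℤ, D (l + c) (m + c) = D l m := by
    intro c
    induction c using Int.induction_on with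
    | zero => simp
    | succ n ih => intro l m; rw [← add_assoc, ← add_assoc, hloc.shift, ih]
    | pred n ih =>
      intro l m
      rw [← hloc.shift, ← ih l m]
      congr 1 <;> ring
  have hDf : ∀ l m, D l m = D (l - m) 0 := fun l m => by
    have := hshift m (l - m) 0
    simpa using this
  have hf0 : (fun n => D n 0) ≠ 0 := fun h0 => hD.ne_zero <| by
    funext l m
    rw [hDf]
    exact congrFun h0 _
  obtain ⟨r, A, k, hr, hrε, hrM, hA, hk, hs⟩ :=
    exists_division_kernel hM (f := fun n => D n 0) (fun n => by simpa using h n 0) hf0 hε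
  refine ⟨r, hrε, k, hr, ⟨A, hA, hk⟩, ⟨L, hL, M, hrM, h⟩, fun c m l' => ?_⟩
  have h1 := ((Equiv.subRight c).hasSum_iff).mpr (hs (m - c) (l' - c))
  simp only [sub_left_inj] at h1
  refine h1.congr_fun' fun l => ?_
  simp only [comp_apply, Equiv.subRight_apply, sub_sub_sub_cancel_right]
  rw [hDf l' l]

lemma IsDivisionKernel.norm_mul_le {r : ℝ} (hk : IsDivisionKernel D k r) {C : Coeff I}
    (hC : DecaysFaster r C) : ∃ B > 0, ∃ ε > 0, ∀ (w : Fin (I + 1) → Species)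
      (m' : Fin (I + 1) → ℤ) (j : Fin (I + 1)) (c n : ℤ), m' 0 = c →
      ‖k (n - c) (m' j - c) * C w m'‖ ≤ B * Real.exp (-ε * |((m' j - c : ℤ) : ℝ)|) := by
  obtain ⟨A, hA, hk'⟩ := hk.bound
  obtain ⟨L, hL, M, hM, h⟩ := hC
  refine ⟨A * L, by positivity, M - r, sub_pos.mpr hM, fun w m' j c n hc => ?_⟩
  rw [norm_mul]
  refine (mul_le_mul (hk' _ _) (h _ _) (norm_nonneg _) (by positivity)).trans ?_
  rw [mul_mul_mul_comm, ← Real.exp_add]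
  refine mul_le_mul_of_nonneg_left (Real.exp_le_exp.mpr ?_) (by positivity)
  have h1 := abs_sub_le_spread m' j
  rw [hc, abs_sub_comm] at h1
  push_cast
  have h2 := mul_le_mul_of_nonneg_left h1 (hk.pos.trans hM).le
  have h3 := mul_nonneg hk.pos.le (abs_nonneg ((n : ℝ) - c))
  linarith

lemma IsDivisionKernel.summable_mul {r : ℝ} (hk : IsDivisionKernel D k r) {C : Coeff I}
    (hC : DecaysFaster r C) (w : Fin (I + 1) → Species) (m : Fin (I + 1) → ℤ) {j : Fin (I + 1)}
    (hj : j ≠ 0) : Summable fun l => k (m j - m 0) (l - m 0) * C w (update m j l) := by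
  obtain ⟨B, hB, ε, hε, h⟩ := hk.norm_mul_le hC
  refine .of_norm_bounded ((summable_exp_sub hε (m 0)).mul_left B) fun l => ?_
  have := h w (update m j l) j (m 0) (m j) (update_of_ne hj.symm _ _)
  rwa [update_self] at this

lemma divSlot_mem {r : ℝ} (hk : IsDivisionKernel D k r) {C : Coeff I} (hC : C ∈ localCoeff I)
    (hCr : DecaysFaster r C) {j : Fin (I + 1)} (hj : j ≠ 0) :
    divSlot k s α β j C ∈ localCoeff I := by
  intro w
  obtain ⟨A, hA, hk'⟩ := hk.bound
  obtain ⟨L, hL, M, hM, h⟩ := hCr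
  by_cases hw : isUp (w j) = true ∧ (w j).2 = s
  · have h1 := isTILC_division hk.pos hA hk' (hC (update w j (lower (w j)))).1 hL hM (h _) hj
    have h2 := h1.const_mul (passSign w j * (koszulCoeff α β (w j))⁻¹)
    convert! h2 using 1
    funext m
    rw [divSlot_apply, if_pos hw, ← mul_assoc]
    rfl
  · have : divSlot k s α β j C w = 0 := by
      funext m
      rw [divSlot_apply, if_neg hw]
      rfl
    rw [this]
    exact isTILC_zero

lemma divSlot_add {r : ℝ} (hk : IsDivisionKernel D k r) {C E : Coeff I}
    (hC : DecaysFaster r C) (hE : DecaysFaster r E) {j : Fin (I + 1)} (hj : j ≠ 0)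
    (w : Fin (I + 1) → Species) (m : Fin (I + 1) → ℤ) :
    divSlot k s α β j (C + E) w m = divSlot k s α β j C w m + divSlot k s α β j E w m := by
  simp only [divSlot_apply]
  split_ifs
  · rw [← mul_add, ← mul_add, ← (hk.summable_mul hC _ m hj).tsum_add (hk.summable_mul hE _ m hj)]
    simp only [Pi.add_apply, mul_add]
  · simp

lemma decaysFaster_zero (r : ℝ) : DecaysFaster r (0 : Coeff I) :=
  ⟨1, one_pos, r + 1, by simp, fun _ _ => by simp; positivity⟩

lemma DecaysFaster.add {r : ℝ} {C E : Coeff I} (hC : DecaysFaster r C) (hE : DecaysFaster r E) :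
    DecaysFaster r (C + E) := by
  obtain ⟨L, hL, M, hM, h⟩ := hC
  obtain ⟨L', hL', M', hM', h'⟩ := hE
  refine ⟨L + L', by positivity, min M M', lt_min hM hM', fun w m => ?_⟩
  have hs := spread_nonneg m
  calc ‖C w m + E w m‖ ≤ L * Real.exp (-M * spread m) + L' * Real.exp (-M' * spread m) :=
        (norm_add_le _ _).trans (add_le_add (h w m) (h' w m))
    _ ≤ L * Real.exp (-min M M' * spread m) + L' * Real.exp (-min M M' * spread m) := by
        gcongr
        · exact min_le_left _ _
        · exact min_le_right _ _
    _ = _ := by ring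

lemma decaysFaster_sum {r : ℝ} {ι : Type*} (t : Finset ι) {C : ι → Coeff I}
    (hC : ∀ i ∈ t, DecaysFaster r (C i)) : DecaysFaster r (∑ i ∈ t, C i) := by
  classical
  induction t using Finset.induction_on with
  | empty => simpa using decaysFaster_zero r
  | insert i t hi ih =>
    rw [Finset.sum_insert hi]
    exact (hC i (Finset.mem_insert_self _ _)).add
      (ih fun k hk => hC k (Finset.mem_insert_of_mem hk))

lemma divSlot_zero (j : Fin (I + 1)) : divSlot k s α β j (0 : Coeff I) = 0 := by
  funext w m
  simp [divSlot_apply]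

lemma divSlot_sum {r : ℝ} (hk : IsDivisionKernel D k r) {ι : Type*} (t : Finset ι)
    {C : ι → Coeff I} (hC : ∀ i ∈ t, DecaysFaster r (C i)) {j : Fin (I + 1)} (hj : j ≠ 0)
    (w : Fin (I + 1) → Species) (m : Fin (I + 1) → ℤ) :
    divSlot k s α β j (∑ i ∈ t, C i) w m = ∑ i ∈ t, divSlot k s α β j (C i) w m := by
  classical
  induction t using Finset.induction_on with
  | empty => simp [divSlot_zero]
  | insert i t hi ih =>
    rw [Finset.sum_insert hi, Finset.sum_insert hi,
      divSlot_add hk (hC i (Finset.mem_insert_self _ _))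
        (decaysFaster_sum t fun k hk => hC k (Finset.mem_insert_of_mem hk)) hj,
      ih fun k hk => hC k (Finset.mem_insert_of_mem hk)]

/-- As `i` is not the first position, the Koszul factor leaves the origin of the division alone. For
fixed `m` the division is then an ordinary slot operator. -/
lemma slot_koszul_divSlot {r : ℝ} (hD : IsLocalMatrix D) (hk : IsDivisionKernel D k r)
    {C : Coeff I} (hC : DecaysFaster r C) {i j : Fin (I + 1)} (hi : i ≠ 0) (hj : j ≠ 0)
    (hij : i ≠ j) : slot (koszul D s α β) i (divSlot k s α β j C) =
      -divSlot k s α β j (slot (koszul D s α β) i C) := by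
  have hK := isLocalKernel_koszul hD s α β
  funext w m
  -- Here the origin is frozen at `m 0`.
  have h1 : slot (koszul D s α β) i (divSlot k s α β j C) w m =
      slot (koszul D s α β) i (slot (divKernel k s α β (m 0)) j C) w m := by
    simp only [slot, divSlot, update_of_ne hi.symm]
  rw [h1]
  refine slot_slot_swap hK.odd (divKernel_odd k s α β (m 0)) hij fun a b => ?_
  obtain ⟨B, hB, ε, hε, h⟩ := hk.norm_mul_le hC
  have h2 := (((hK.isLocalMatrix a (w i)).summable_norm (m i)).mul_of_nonneg
    ((summable_exp_sub hε (m 0)).mul_left (‖(koszulCoeff α β (w j))⁻¹‖ * B))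
    (fun _ => norm_nonneg _) (fun _ => by positivity))
  refine .of_norm_bounded h2 fun p => ?_
  rw [norm_mul]
  gcongr
  have h3 := h (update (update w i a) j b) (update (update m i p.1) j p.2) j (m 0) (m j)
    (by rw [update_of_ne hj.symm, update_of_ne hi.symm])
  rw [update_self] at h3
  unfold divKernel
  split_ifs
  · rw [mul_assoc, norm_mul, mul_assoc]
    gcongr
  · simp; positivity
  · simp; positivity

lemma summable_exp_sub_mul {x y : ℝ} (hx : 0 < x) (hy : 0 < y) (c : ℤ) :
    Summable fun p : ℤ × ℤ => Real.exp (-x * |((p.2 - p.1 : ℤ) : ℝ)|) *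
      Real.exp (-y * |((p.2 - c : ℤ) : ℝ)|) := by
  have h := (summable_exp_neg_mul_abs hy).mul_of_nonneg (summable_exp_neg_mul_abs hx)
    (fun _ => (Real.exp_pos _).le) (fun _ => (Real.exp_pos _).le)
  refine (((Equiv.prodComm ℤ ℤ).trans (Equiv.prodShear (Equiv.subRight c)
    fun l' => Equiv.subLeft l')).summable_iff.mpr h).congr fun p => ?_
  simp [mul_comm]

/-- The growth in |l - m 0| is split by the triangle inequality between the decay of `D` in l' - l
and that of `C` in l' - m 0, both of rate larger than `r`. -/
lemma summable_division {r : ℝ} (hk : IsDivisionKernel D k r) {C : Coeff I}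
    (hC : DecaysFaster r C) (w : Fin (I + 1) → Species) (m : Fin (I + 1) → ℤ) {j : Fin (I + 1)}
    (hj : j ≠ 0) : Summable fun p : ℤ × ℤ =>
      k (m j - m 0) (p.1 - m 0) * (D p.2 p.1 * C w (update m j p.2)) := by
  obtain ⟨A, hA, hk'⟩ := hk.bound
  obtain ⟨L, hL, M, hM, h⟩ := hC
  obtain ⟨L', hL', M', hM', h'⟩ := hk.decay
  refine .of_norm_bounded ((summable_exp_sub_mul (sub_pos.mpr hM') (sub_pos.mpr hM)
    (m 0)).mul_left (A * L * L')) fun p => ?_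
  rw [norm_mul, norm_mul]
  refine (mul_le_mul (hk' _ _) (mul_le_mul (h' _ _) (h _ _) (norm_nonneg _)
    (mul_nonneg hL'.le (Real.exp_pos _).le)) (by positivity)
    (mul_nonneg hA.le (Real.exp_pos _).le)).trans ?_
  have h0 : ∀ x y z : ℝ, A * x * (L' * y * (L * z)) = A * L * L' * (x * y * z) :=
    fun x y z => by ring
  rw [h0, ← Real.exp_add, ← Real.exp_add, ← Real.exp_add]
  refine mul_le_mul_of_nonneg_left (Real.exp_le_exp.mpr ?_) (by positivity)
  have h1 := abs_sub_le_spread (update m j p.2) j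
  rw [update_self, update_of_ne hj.symm, abs_sub_comm] at h1
  have h2 := mul_le_mul_of_nonneg_left h1 (hk.pos.trans hM).le
  have h3 := mul_nonneg hk.pos.le (abs_nonneg ((m j : ℝ) - m 0))
  have h4 : |(p.1 : ℝ) - m 0| ≤ |(p.2 : ℝ) - p.1| + |(p.2 : ℝ) - m 0| := by
    rw [abs_sub_comm (p.2 : ℝ) p.1]
    exact abs_sub_le _ _ _
  have h5 := mul_le_mul_of_nonneg_left h4 hk.pos.le
  push_cast
  linarith

lemma tsum_division {r : ℝ} (hk : IsDivisionKernel D k r) {C : Coeff I} (hC : DecaysFaster r C)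
    (w : Fin (I + 1) → Species) (m : Fin (I + 1) → ℤ) {j : Fin (I + 1)} (hj : j ≠ 0) :
    ∑' l, k (m j - m 0) (l - m 0) * ∑' l', D l' l * C w (update m j l') = C w m := by
  simp_rw [← tsum_mul_left]
  rw [← Summable.tsum_comm (f := fun l l' => k (m j - m 0) (l - m 0) *
    (D l' l * C w (update m j l'))) (summable_division hk hC w m hj)]
  have h1 : ∀ l', ∑' l, k (m j - m 0) (l - m 0) * (D l' l * C w (update m j l')) =
      if l' = m j then C w m else 0 := by
    intro l'
    simp_rw [← mul_assoc]
    rw [tsum_mul_right, (hk.hasSum _ _ _).tsum_eq]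
    by_cases hl : m j = l'
    · rw [if_pos hl, if_pos hl.symm, one_mul, ← hl, update_eq_self]
    · rw [if_neg hl, if_neg (Ne.symm hl), zero_mul]
  simp_rw [h1]
  exact tsum_ite_eq _ _

/-- Division is a left inverse of ∇ on decaying sequences. The opposite composition is not the
identity: division produces a preimage only of sequences that are divisible. -/
lemma divSlot_slot_koszul {r : ℝ} (hα : α ≠ 0) (hβ : β ≠ 0) (hk : IsDivisionKernel D k r)
    {C : Coeff I} (hC : DecaysFaster r C) {j : Fin (I + 1)} (hj : j ≠ 0)
    (w : Fin (I + 1) → Species) (m : Fin (I + 1) → ℤ) :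
    divSlot k s α β j (slot (koszul D s α β) j C) w m =
      if isUp (w j) = true ∧ (w j).2 = s then C w m else 0 := by
  rw [divSlot_apply]
  split_ifs with hw
  · have hc := koszulCoeff_ne_zero hα hβ (w j)
    have h1 : ∀ l, slot (koszul D s α β) j C (update w j (lower (w j))) (update m j l) =
        passSign w j * (koszulCoeff α β (w j) * ∑' l', D l' l * C w (update m j l')) := fun l => by
      simp [slot_koszul, isUp_lower, snd_lower, hw.2, koszulCoeff_lower, raise_lower hw.1,
        passSign_update_self]
    have h2 : ∀ l, k (m j - m 0) (l - m 0) * (passSign w j * (koszulCoeff α β (w j) *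
        ∑' l', D l' l * C w (update m j l'))) = passSign w j * koszulCoeff α β (w j) *
        (k (m j - m 0) (l - m 0) * ∑' l', D l' l * C w (update m j l')) := fun l => by ring
    simp only [h1, h2, tsum_mul_left]
    rw [tsum_division hk hC w m hj]
    calc _ = passSign w j * passSign w j *
          ((koszulCoeff α β (w j))⁻¹ * (koszulCoeff α β (w j) * C w m)) := by ring
      _ = _ := by rw [passSign_mul_self, one_mul, inv_mul_cancel_left₀ hc]
  · rfl

/-- One step of the elimination: a Koszul boundary removes the words of a cycle with an up letter in
the position `j`. -/
lemma exists_elimination (hD : IsDifferenceOperator D) (hα : α ≠ 0) (hβ : β ≠ 0)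
    {J : Finset (Fin (I + 1))} (hJ : 0 ∉ J) {j : Fin (I + 1)} (hj : j ∈ J) {R : Coeff I}
    (hR : R ∈ localCoeff I) (hKR : derivOn J (koszul D s α β) R = 0)
    (hs : ∀ w m, R w m ≠ 0 → ∀ i, (w i).2 = s) :
    ∃ V ∈ localCoeff I, ∀ w, (isUp (w j) = true ∨ R w = 0) →
      (R - derivOn J (koszul D s α β) V) w = 0 := by
  have hloc := hD.isLocalMatrix
  have hK := isLocalKernel_koszul hloc s α β
  have hne : ∀ i ∈ J, i ≠ 0 := fun i hi h => hJ (h ▸ hi)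
  obtain ⟨ε, hε, hεR⟩ := exists_decaysFaster hR
  choose δ hδ hδR using fun i => exists_decaysFaster (slot_mem hK i hR)
  obtain ⟨i₀, hi₀⟩ := Finite.exists_min δ
  -- One kernel must divide `R` and all its partial differentials, so `r` lies below all their decay
  -- rates.
  obtain ⟨r, hr, k, hk⟩ := exists_isDivisionKernel hD (lt_min hε (hδ i₀))
  have hRr := hεR r (hr.trans_le (min_le_left _ _))
  have hKr : ∀ i, DecaysFaster r (slot (koszul D s α β) i R) := fun i =>
    hδR i r (hr.trans_le ((min_le_right _ _).trans (hi₀ i)))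
  refine ⟨divSlot k s α β j R, divSlot_mem hk hR hRr (hne j hj), fun w hw => ?_⟩
  -- The cycle condition, solved for factor `j`. Moving the division past the other factors then
  -- yields the homotopy formula K V = K_j V + (R at words with an up letter at `j`).
  have h1 : ∑ i ∈ J.erase j, slot (koszul D s α β) i R = -slot (koszul D s α β) j R := by
    rw [derivOn, ← Finset.add_sum_erase _ _ hj] at hKR
    exact eq_neg_of_add_eq_zero_right hKR
  have hneg : ∀ C : Coeff I, divSlot k s α β j (-C) = -divSlot k s α β j C := fun C => by
    funext w m
    simp only [divSlot_apply, Pi.neg_apply, mul_neg, tsum_neg]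
    split_ifs <;> simp
  have h2 : ∀ m, derivOn J (koszul D s α β) (divSlot k s α β j R) w m =
      slot (koszul D s α β) j (divSlot k s α β j R) w m +
        if isUp (w j) = true ∧ (w j).2 = s then R w m else 0 := by
    intro m
    rw [derivOn_apply, ← Finset.add_sum_erase _ _ hj]
    congr 1
    have h3 : ∀ i ∈ J.erase j, slot (koszul D s α β) i (divSlot k s α β j R) w m =
        -divSlot k s α β j (slot (koszul D s α β) i R) w m := fun i hi => by
      rw [slot_koszul_divSlot hloc hk hRr (hne i (Finset.mem_of_mem_erase hi)) (hne j hj)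
        (Finset.ne_of_mem_erase hi)]
      rfl
    rw [Finset.sum_congr rfl h3, Finset.sum_neg_distrib,
      ← divSlot_sum hk _ (fun i _ => hKr i) (hne j hj), h1, hneg, Pi.neg_apply, Pi.neg_apply,
      neg_neg, divSlot_slot_koszul hα hβ hk hRr (hne j hj)]
  funext m
  rw [Pi.sub_apply, Pi.sub_apply, h2, slot_koszul, Pi.zero_apply]
  rcases hw with hw | hw
  · rw [if_neg (by simp [hw]), zero_add]
    split_ifs with h
    · exact sub_self _
    · by_contra hne'
      exact h ⟨hw, hs w m (by simpa using hne') j⟩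
  -- The remainder must not acquire new words: raising and lowering at `j` returns to `w`, where `R`
  -- vanishes. This keeps the words already eliminated at other positions absent.
  · simp only [hw, Pi.zero_apply, ite_self, add_zero, zero_sub, neg_eq_zero]
    split_ifs with h
    · have h4 : ∀ l, divSlot k s α β j R (update w j (raise (w j))) (update m j l) = 0 := by
        intro l
        simp [divSlot_apply, lower_raise h.1, hw]
      simp [h4]
    · rfl

lemma exists_koszul_primitive_of_zero_notMem (hD : IsDifferenceOperator D) (hα : α ≠ 0)
    (hβ : β ≠ 0) {J : Finset (Fin (I + 1))} (hJ : 0 ∉ J) {R : Coeff I} (hR : R ∈ localCoeff I)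
    (hKR : derivOn J (koszul D s α β) R = 0) (hs : ∀ w m, R w m ≠ 0 → ∀ i, (w i).2 = s)
    (hup : ∀ w m, R w m ≠ 0 → ∃ i ∈ J, isUp (w i) = true) :
    ∃ U ∈ localCoeff I, derivOn J (koszul D s α β) U = R := by
  have hloc := hD.isLocalMatrix
  have hK := isLocalKernel_koszul hloc s α β
  -- Eliminate the positions of `A` one by one. The alternative `R w = 0` carries along that no new
  -- words appear.
  have key : ∀ A : Finset (Fin (I + 1)), A ⊆ J → ∃ U ∈ localCoeff I, ∀ w,
      ((∃ j ∈ A, isUp (w j) = true) ∨ R w = 0) → (R - derivOn J (koszul D s α β) U) w = 0 := by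
    intro A
    induction A using Finset.induction_on with
    | empty =>
      intro _
      refine ⟨0, Submodule.zero_mem _, fun w hw => ?_⟩
      simpa [derivOn_zero] using hw
    | insert j A hjA ih =>
      intro hA
      obtain ⟨U, hU, h⟩ := ih fun i hi => hA (Finset.mem_insert_of_mem hi)
      have hR' : R - derivOn J (koszul D s α β) U ∈ localCoeff I :=
        Submodule.sub_mem _ hR (derivOn_mem hK J hU)
      obtain ⟨V, hV, h'⟩ := exists_elimination hD hα hβ hJ (hA (Finset.mem_insert_self _ _)) hR'
        (by rw [derivOn_sub hK J hR (derivOn_mem hK J hU), hKR, derivOn_koszul_sq hloc J hU,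
          sub_zero])
        (fun w m hw => by
          have h0 : R w ≠ 0 := fun h0 => hw (congrFun (h w (.inr h0)) m)
          obtain ⟨m', hm'⟩ := Function.ne_iff.mp h0
          exact hs w m' hm')
      · refine ⟨U + V, Submodule.add_mem _ hU hV, fun w hw => ?_⟩
        rw [derivOn_add hK J hU hV, ← sub_sub]
        apply h'
        rcases hw with ⟨i, hi, hi'⟩ | hw
        · rcases Finset.mem_insert.mp hi with rfl | hi
          · exact .inl hi'
          · exact .inr (h w (.inl ⟨i, hi, hi'⟩))
        · exact .inr (h w (.inr hw))
  obtain ⟨U, hU, h⟩ := key J subset_rfl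
  refine ⟨U, hU, ?_⟩
  funext w
  have h1 : (R - derivOn J (koszul D s α β) U) w = 0 := by
    apply h
    by_cases hw : R w = 0
    · exact .inr hw
    · obtain ⟨m, hm⟩ := Function.ne_iff.mp hw
      exact .inl (hup w m hm)
  exact (sub_eq_zero.mp h1).symm

end Koszul

end LatticeSUSY

/-! ### Exactness of the Koszul complex -/

namespace LatticeSUSY

open Function

section KoszulExact

variable {I : ℕ} {D : ℤ → ℤ → ℂ} {s : Sgn} {α β : ℂ}

/-- The number of the letters `χ`, `F` of a word. -/
def upCount (w : Fin (I + 1) → Species) : ℕ :=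
  (Finset.univ.filter fun i => isUp (w i) = true).card

/-- The words with letters of sign `s` only. -/
def IsPure (s : Sgn) (w : Fin (I + 1) → Species) : Prop := ∀ i, (w i).2 = s

instance (s : Sgn) (w : Fin (I + 1) → Species) : Decidable (IsPure s w) :=
  inferInstanceAs (Decidable (∀ i, (w i).2 = s))

lemma koszul_ne_zero {a b : Species} {l m : ℤ} (h : koszul D s α β a b l m ≠ 0) :
    a = raise b ∧ isUp b = false ∧ b.2 = s := by
  unfold koszul at h
  split_ifs at h with h1 h2
  · exact ⟨h1, h2⟩
  · exact absurd rfl h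
  · exact absurd rfl h

lemma upCount_update_raise {w : Fin (I + 1) → Species} {j : Fin (I + 1)}
    (h : isUp (w j) = false) : upCount (update w j (raise (w j))) = upCount w + 1 := by
  unfold upCount
  rw [← Finset.card_insert_of_notMem (a := j)
    (s := Finset.univ.filter fun i => isUp (w i) = true) (by simp [h])]
  congr 1
  ext i
  by_cases hi : i = j
  · subst hi; simp [isUp_raise]
  · simp [hi]

lemma isPure_update {w : Fin (I + 1) → Species} {j : Fin (I + 1)} {a : Species}
    (h : a.2 = (w j).2) : IsPure s (update w j a) ↔ IsPure s w := by
  refine forall_congr' fun i => ?_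
  by_cases hi : i = j
  · subst hi; simp [h]
  · simp [hi]

lemma upCount_le_one_of_forall {w : Fin (I + 1) → Species}
    (h : ∀ i ∈ Finset.univ.erase (0 : Fin (I + 1)), ¬ isUp (w i) = true) : upCount w ≤ 1 := by
  refine (Finset.card_le_card (t := {0}) fun i hi => ?_).trans (by simp)
  by_contra h0
  exact h i (by simpa using h0) (Finset.mem_filter.mp hi).2

lemma derivOn_univ_eq (A : Kernel) (C : Coeff I) : derivOn Finset.univ A C =
    slot A 0 C + derivOn (Finset.univ.erase 0) A C :=
  (Finset.add_sum_erase _ _ (Finset.mem_univ _)).symm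

/-- Exactness of the Koszul complex of `∇` at words with at least two letters `χ`, `F`. -/
theorem exists_koszul_primitive (hD : IsDifferenceOperator D) (hα : α ≠ 0) (hβ : β ≠ 0)
    {R : Coeff I} (hR : R ∈ localCoeff I) (hKR : derivOn Finset.univ (koszul D s α β) R = 0)
    (hs : ∀ w m, R w m ≠ 0 → IsPure s w ∧ 2 ≤ upCount w) :
    ∃ U ∈ localCoeff I, derivOn Finset.univ (koszul D s α β) U = R := by
  classical
  have hloc := hD.isLocalMatrix
  have hK := isLocalKernel_koszul hloc s α β
  set K := koszul D s α β
  set J := Finset.univ.erase (0 : Fin (I + 1))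
  have hJ : (0 : Fin (I + 1)) ∉ J := Finset.notMem_erase _ _
  have hexists : ∀ w m, R w m ≠ 0 → ∃ i ∈ J, isUp (w i) = true := fun w m h => by
    by_contra! hcon
    have := upCount_le_one_of_forall hcon
    have := (hs w m h).2
    omega
  -- `θ` projects onto an up letter in the first place. `θ₃` and `θ₂` differ by one in the count
  -- because the differential lowers one up letter.
  let θ : (Fin (I + 1) → Species) → ℂ := fun w => if isUp (w 0) = true then 1 else 0
  let θ₂ : (Fin (I + 1) → Species) → ℂ := fun w => if IsPure s w ∧ 2 ≤ upCount w then 1 else 0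
  let θ₃ : (Fin (I + 1) → Species) → ℂ := fun w => if IsPure s w ∧ 3 ≤ upCount w then 1 else 0
  have hθ : ∀ C : Coeff I, derivOn J K (wordMul θ C) = wordMul θ (derivOn J K C) := fun C =>
    derivOn_wordMul fun w j hj a l m _ _ => by
      simp only [θ]
      rw [update_of_ne (Finset.ne_of_mem_erase hj).symm]
  have hθ₃ : ∀ C : Coeff I, derivOn Finset.univ K (wordMul θ₃ C) =
      wordMul θ₂ (derivOn Finset.univ K C) := fun C =>
    derivOn_wordMul fun w j _ a l m h _ => by
      obtain ⟨rfl, h1, -⟩ := koszul_ne_zero h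
      simp only [θ₂, θ₃, isPure_update (snd_raise _), upCount_update_raise h1]
      congr 2
      simp
  have hslot : ∀ (C : Coeff I) w m, isUp (w 0) = true → slot K 0 C w m = 0 := fun C w m h => by
    simp only [K, slot_koszul, h]
    simp
  -- The differential in the first factor only produces words with a low first letter, so the part
  -- with an up first letter is a cycle for the other factors.
  have hKup : derivOn J K (wordMul θ R) = 0 := by
    rw [hθ]
    funext w m
    simp only [wordMul, θ]
    split_ifs with h
    · have h1 := congrFun (congrFun hKR w) m
      rw [derivOn_univ_eq, Pi.add_apply, Pi.add_apply, hslot R w m h, zero_add] at h1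
      rw [one_mul]
      exact h1
    · simp
  obtain ⟨V, hV, hKV⟩ := exists_koszul_primitive_of_zero_notMem hD hα hβ hJ
    (wordMul_mem θ hR) hKup (fun w m h => (hs w m (right_ne_zero_of_mul h)).1)
    (fun w m h => hexists w m (right_ne_zero_of_mul h))
  -- Cutting `V` down to an up first letter and at least three up letters makes its boundary remove
  -- that part of `R` without creating words outside the allowed support.
  set V₁ := wordMul θ₃ (wordMul θ V)
  have hV₁ : V₁ ∈ localCoeff I := wordMul_mem _ (wordMul_mem _ hV)
  set R₁ := R - derivOn Finset.univ K V₁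
  have hR₁ : R₁ ∈ localCoeff I := Submodule.sub_mem _ hR (derivOn_mem hK _ hV₁)
  have hKR₁ : derivOn Finset.univ K R₁ = 0 := by
    rw [derivOn_sub hK _ hR (derivOn_mem hK _ hV₁), hKR, derivOn_koszul_sq hloc _ hV₁, sub_zero]
  have hR₁s : ∀ w m, R₁ w m ≠ 0 → (IsPure s w ∧ 2 ≤ upCount w) ∧ isUp (w 0) = false := by
    intro w m h
    have h1 : R₁ w m = R w m - θ₂ w * derivOn Finset.univ K (wordMul θ V) w m := by
      simp only [R₁, V₁, hθ₃]
      rfl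
    have h2 : IsPure s w ∧ 2 ≤ upCount w := by
      by_contra hcon
      have h3 : R w m = 0 := by
        by_contra h0
        exact hcon (hs w m h0)
      exact h (by rw [h1, h3]; simp [θ₂, hcon])
    refine ⟨h2, ?_⟩
    by_contra hup
    rw [Bool.not_eq_false] at hup
    refine h ?_
    rw [h1, derivOn_univ_eq, hθ, hKV]
    simp only [Pi.add_apply, hslot _ w m hup, wordMul, θ, θ₂, if_pos hup, if_pos h2]
    ring
  -- With no up letter left in the first place there is nothing for the first factor to
  -- differentiate, so the full cycle condition reduces to `J`.
  have hK₁ : derivOn J K R₁ = 0 := by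
    have h1 : slot K 0 R₁ = 0 := by
      funext w m
      simp only [K, slot_koszul]
      split_ifs with h
      · have h2 : ∀ l, R₁ (update w 0 (raise (w 0))) (update m 0 l) = 0 := fun l => by
          by_contra h0
          have := (hR₁s _ _ h0).2
          rw [update_self, isUp_raise] at this
          cases this
        simp [h2]
      · rfl
    rw [derivOn_univ_eq, h1, zero_add] at hKR₁
    exact hKR₁
  obtain ⟨W, hW, hKW⟩ := exists_koszul_primitive_of_zero_notMem hD hα hβ hJ hR₁ hK₁
    (fun w m h => (hR₁s w m h).1.1) (fun w m h => by
      by_contra! hcon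
      have := upCount_le_one_of_forall hcon
      have := (hR₁s w m h).1.2
      omega)
  -- Dropping the words of `W` with an up first letter makes the full differential of the primitive
  -- agree with that of `J`.
  have hW₁ : W - wordMul θ W ∈ localCoeff I := Submodule.sub_mem _ hW (wordMul_mem _ hW)
  have hKW₁ : derivOn Finset.univ K (W - wordMul θ W) = R₁ := by
    have h1 : slot K 0 (W - wordMul θ W) = 0 := by
      funext w m
      simp only [K, slot_koszul]
      split_ifs with h
      · simp [wordMul, θ, isUp_raise]
      · rfl
    rw [derivOn_univ_eq, h1, zero_add, derivOn_sub hK J hW (wordMul_mem _ hW), hθ, hKW]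
    funext w m
    simp only [Pi.sub_apply, wordMul]
    by_cases h0 : R₁ w m = 0
    · simp [h0]
    · simp [θ, (hR₁s w m h0).2]
  refine ⟨V₁ + (W - wordMul θ W), Submodule.add_mem _ hV₁ hW₁, ?_⟩
  rw [derivOn_add hK _ hV₁ hW₁, hKW₁]
  simp [R₁]

end KoszulExact

/-! ### Grassmann signs of permutations and graded averaging -/

section Symmetrization

variable {I : ℕ}

/-- A product of a symmetric function over unordered pairs is invariant under relabelling.
Multiplying by the differences i - j reduces it to the antisymmetric case, where the sign of σ
appears on both sides and cancels. -/
lemma prod_Iio_comp_perm {n : ℕ} (σ : Equiv.Perm (Fin n)) {f : Fin n → Fin n → ℂ}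
    (hf : ∀ i j, f i j = f j i) :
    ∏ j, ∏ i ∈ Finset.Iio j, f (σ i) (σ j) = ∏ j, ∏ i ∈ Finset.Iio j, f i j := by
  have h1 := σ.prod_Iio_comp_eq_sign_mul_prod (R := ℂ)
    (f := fun i j => f i j * (((i : ℕ) : ℂ) - ((j : ℕ) : ℂ))) (fun i j => by rw [hf]; ring)
  have h2 := σ.prod_Iio_comp_eq_sign_mul_prod (R := ℂ)
    (f := fun i j => (((i : ℕ) : ℂ) - ((j : ℕ) : ℂ))) (fun i j => by ring)
  simp only [Finset.prod_mul_distrib] at h1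
  rw [h2] at h1
  have h3 : ∏ j : Fin n, ∏ i ∈ Finset.Iio j, (((i : ℕ) : ℂ) - ((j : ℕ) : ℂ)) ≠ 0 := by
    refine Finset.prod_ne_zero_iff.mpr fun j _ => Finset.prod_ne_zero_iff.mpr fun i hi => ?_
    rw [sub_ne_zero]
    have h : i < j := Finset.mem_Iio.mp hi
    have h' : (i : ℕ) < j := h
    exact_mod_cast h'.ne
  have h4 : ((σ.sign : ℤ) : ℂ) ≠ 0 := by
    rcases Int.units_eq_one_or σ.sign with h | h <;> simp [h]
  have h5 := mul_ne_zero h4 h3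
  refine mul_right_cancel₀ h5 ?_
  rw [h1]
  ring

/-- The sign for the pair of positions `p, q` of the word `w ∘ σ`. -/
def pairSign (σ : Equiv.Perm (Fin (I + 1))) (o : Fin (I + 1) → Bool) (p q : Fin (I + 1)) : ℂ :=
  if (o (σ p) && o (σ q)) && (xor (decide (p < q)) (decide (σ p < σ q))) then -1 else 1

/-- The Grassmann sign of the permutation `σ` of factors with parities `o`. -/
noncomputable def permSign (σ : Equiv.Perm (Fin (I + 1))) (o : Fin (I + 1) → Bool) : ℂ :=
  ∏ q, ∏ p ∈ Finset.Iio q, pairSign σ o p q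

lemma pairSign_comm (σ : Equiv.Perm (Fin (I + 1))) (o : Fin (I + 1) → Bool)
    (p q : Fin (I + 1)) : pairSign σ o p q = pairSign σ o q p := by
  rcases lt_trichotomy p q with h | rfl | h
  · have h' : σ p ≠ σ q := σ.injective.ne h.ne
    unfold pairSign
    rcases lt_or_gt_of_ne h' with h'' | h'' <;>
      simp [h, h'', h.not_gt, h''.not_gt, Bool.and_comm]
  · rfl
  · have h' : σ p ≠ σ q := σ.injective.ne h.ne'
    unfold pairSign
    rcases lt_or_gt_of_ne h' with h'' | h'' <;>
      simp [h, h'', h.not_gt, h''.not_gt, Bool.and_comm]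

/-- Cocycle identity: a pair is inverted by the product exactly when one of the two factors inverts
it. -/
lemma permSign_mul (σ τ : Equiv.Perm (Fin (I + 1))) (o : Fin (I + 1) → Bool) :
    permSign (σ * τ) o = permSign σ o * permSign τ (o ∘ σ) := by
  unfold permSign
  rw [← prod_Iio_comp_perm τ (pairSign_comm σ o)]
  simp only [← Finset.prod_mul_distrib]
  refine Finset.prod_congr rfl fun q _ => Finset.prod_congr rfl fun p _ => ?_
  unfold pairSign
  simp only [Equiv.Perm.coe_mul, comp_apply]
  have key : ∀ x y a b c : Bool, (if ((x && y) && xor a c) = true then (-1 : ℂ) else 1) =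
      (if ((x && y) && xor b c) = true then -1 else 1) *
        if ((x && y) && xor a b) = true then -1 else 1 := by
    rintro (_ | _) (_ | _) (_ | _) (_ | _) (_ | _) <;> simp
  exact key _ _ _ _ _

lemma permSign_eq_one {σ : Equiv.Perm (Fin (I + 1))} {o : Fin (I + 1) → Bool}
    (h : ∀ i j, o i = true → o j = true → i = j) : permSign σ o = 1 := by
  refine Finset.prod_eq_one fun q _ => Finset.prod_eq_one fun p hp => ?_
  unfold pairSign
  rw [if_neg]
  intro hcon
  simp only [Bool.and_eq_true] at hcon
  exact (Finset.mem_Iio.mp hp).ne (σ.injective (h _ _ hcon.1.1 hcon.1.2))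

lemma permSign_swap (i : Fin I) (o : Fin (I + 1) → Bool) :
    permSign (Equiv.swap i.castSucc i.succ) o =
      if o i.castSucc && o i.succ then -1 else 1 := by
  have hlt : i.castSucc < i.succ := Fin.castSucc_lt_succ
  -- An adjacent transposition reverses the order of a single pair.
  have hpair : ∀ p q : Fin (I + 1), p < q → ¬ (p = i.castSucc ∧ q = i.succ) →
      Equiv.swap i.castSucc i.succ p < Equiv.swap i.castSucc i.succ q := by
    intro p q hpq hne
    rw [Equiv.swap_apply_def, Equiv.swap_apply_def]
    split_ifs <;> simp only [Fin.ext_iff, Fin.lt_def, Fin.val_castSucc, Fin.val_succ] at * <;> omega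
  unfold permSign
  rw [Finset.prod_eq_single i.succ, Finset.prod_eq_single i.castSucc]
  · unfold pairSign
    simp [hlt, hlt.not_gt, Bool.and_comm]
  · intro p hp hne
    have h1 := Finset.mem_Iio.mp hp
    have h2 := hpair p _ h1 (fun h => hne h.1)
    unfold pairSign
    simp only [h1, h2]
    simp
  · intro h
    exact absurd (Finset.mem_Iio.mpr hlt) h
  · intro q _ hne
    refine Finset.prod_eq_one fun p hp => ?_
    have h1 := Finset.mem_Iio.mp hp
    have h2 := hpair p _ h1 (fun h => hne h.2)
    unfold pairSign
    simp only [h1, h2]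
    simp
  · intro h
    exact absurd (Finset.mem_univ _) h

end Symmetrization

end LatticeSUSY

namespace LatticeSUSY

open Function

section Symmetrization

variable {I : ℕ}

/-- The graded action of permutations of the factors. -/
noncomputable def act (σ : Equiv.Perm (Fin (I + 1))) (C : Coeff I) : Coeff I := fun w m =>
  permSign σ (isOdd ∘ w) * C (w ∘ σ) (m ∘ σ)

lemma act_act (σ τ : Equiv.Perm (Fin (I + 1))) (C : Coeff I) :
    act σ (act τ C) = act (σ * τ) C := by
  funext w m
  simp only [act, permSign_mul, mul_assoc]
  rfl

lemma act_one (C : Coeff I) : act 1 C = C := by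
  funext w m
  have : permSign (1 : Equiv.Perm (Fin (I + 1))) (isOdd ∘ w) = 1 :=
    Finset.prod_eq_one fun q _ => Finset.prod_eq_one fun p _ => by
      have key : ∀ x b : Bool, (if (x && xor b b) = true then (-1 : ℂ) else 1) = 1 := by
        rintro (_ | _) (_ | _) <;> simp
      exact key _ _
  simp [act, this]

lemma act_mem (σ : Equiv.Perm (Fin (I + 1))) {C : Coeff I} (hC : C ∈ localCoeff I) :
    act σ C ∈ localCoeff I := fun w => ((hC (w ∘ σ)).comp_perm σ).const_mul _

lemma permSign_mul_self (σ : Equiv.Perm (Fin (I + 1))) (o : Fin (I + 1) → Bool) :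
    permSign σ o * permSign σ o = 1 := by
  unfold permSign
  simp only [← Finset.prod_mul_distrib]
  refine Finset.prod_eq_one fun q _ => Finset.prod_eq_one fun p _ => ?_
  unfold pairSign
  split_ifs <;> norm_num

lemma prod_Iio_eq_prod_erase {n : ℕ} {y : Fin n → Fin n → ℂ} (hy : ∀ p q, y p q = y q p)
    {j : Fin n} (h1 : ∀ p q, p ≠ j → q ≠ j → y p q = 1) :
    ∏ q, ∏ p ∈ Finset.Iio q, y p q = ∏ p ∈ Finset.univ.erase j, y p j := by
  rw [← Finset.mul_prod_erase _ _ (Finset.mem_univ j)]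
  have h2 : ∏ p ∈ Finset.Iio j, y p j =
      ∏ p ∈ Finset.univ.erase j, if p < j then y p j else 1 := by
    rw [Finset.prod_ite, Finset.prod_const_one, mul_one]
    refine Finset.prod_congr ?_ fun _ _ => rfl
    ext p
    simp only [Finset.mem_Iio, Finset.mem_filter, Finset.mem_erase, Finset.mem_univ, and_true]
    exact ⟨fun h => ⟨h.ne, h⟩, fun h => h.2⟩
  rw [h2, ← Finset.prod_mul_distrib]
  refine Finset.prod_congr rfl fun q hq => ?_
  have hqj := Finset.ne_of_mem_erase hq
  rcases lt_or_gt_of_ne hqj with h | h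
  · rw [if_pos h, Finset.prod_eq_one, mul_one]
    intro p hp
    exact h1 p q ((Finset.mem_Iio.mp hp).trans h).ne hqj
  · rw [if_neg h.not_gt, one_mul, Finset.prod_eq_single_of_mem j (Finset.mem_Iio.mpr h), hy]
    exact fun p _ hp => h1 p q hp hqj

lemma passSign_eq_prod (w : Fin (I + 1) → Species) (j : Fin (I + 1)) :
    passSign w j = ∏ i, if decide (i < j) && isOdd (w i) then -1 else 1 := by
  unfold passSign
  rw [Finset.prod_filter]
  refine Finset.prod_congr rfl fun i _ => ?_
  by_cases h : i < j <;> simp [h]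

/-- A change of parity at one letter affects only the pairs containing it. The quotient of the signs
counts the odd letters that change sides relative to it, as do the two passing signs. -/
lemma permSign_mul_permSign_update (σ : Equiv.Perm (Fin (I + 1))) {w : Fin (I + 1) → Species}
    {j : Fin (I + 1)} {a : Species} (ha : isOdd a ≠ isOdd (w (σ j))) :
    permSign σ (isOdd ∘ w) * permSign σ (isOdd ∘ update w (σ j) a) =
      passSign (w ∘ σ) j * passSign w (σ j) := by
  have h0 : passSign w (σ j) =
      ∏ i, if decide (σ i < σ j) && isOdd (w (σ i)) then -1 else 1 := by
    rw [passSign_eq_prod]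
    exact (Equiv.prod_comp σ fun i => if decide (i < σ j) && isOdd (w i) then (-1 : ℂ) else 1).symm
  rw [h0, passSign_eq_prod]
  unfold permSign
  simp only [← Finset.prod_mul_distrib]
  rw [prod_Iio_eq_prod_erase (j := j)]
  · rw [← Finset.mul_prod_erase (a := j) Finset.univ _ (Finset.mem_univ j)]
    simp only [lt_irrefl, decide_false, Bool.false_and, Bool.false_eq_true, if_false, one_mul]
    refine Finset.prod_congr rfl fun p hp => ?_
    have hp' : σ p ≠ σ j := σ.injective.ne (Finset.ne_of_mem_erase hp)
    have key : ∀ x y z b c : Bool, y ≠ z →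
        (if ((x && z) && xor b c) = true then (-1 : ℂ) else 1) *
          (if ((x && y) && xor b c) = true then -1 else 1) =
        (if (b && x) = true then -1 else 1) * (if (c && x) = true then -1 else 1) := by
      rintro (_ | _) (_ | _) (_ | _) (_ | _) (_ | _) <;> simp
    have := key (isOdd (w (σ p))) (isOdd a) (isOdd (w (σ j))) (decide (p < j))
      (decide (σ p < σ j)) ha
    simpa only [pairSign, comp_apply, update_self, update_of_ne hp'] using this
  · intro p q
    rw [pairSign_comm, pairSign_comm σ (isOdd ∘ update w (σ j) a)]
  · intro p q hp hq
    unfold pairSign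
    simp only [comp_apply, update_of_ne (σ.injective.ne hp), update_of_ne (σ.injective.ne hq)]
    split_ifs <;> norm_num

/-- Permuting the factors carries the operator from factor `j` to factor `σ j`; the sign identity
above accounts for the odd operator. -/
lemma act_slot {A : Kernel} (hA : IsLocalKernel A) (σ : Equiv.Perm (Fin (I + 1)))
    (j : Fin (I + 1)) (C : Coeff I) : act σ (slot A j C) = slot A (σ j) (act σ C) := by
  funext w m
  simp only [act, slot]
  rw [Finset.mul_sum, Finset.mul_sum, Finset.mul_sum]
  refine Finset.sum_congr rfl fun a _ => ?_
  rw [← tsum_mul_left, ← tsum_mul_left, ← tsum_mul_left]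
  refine tsum_congr fun l => ?_
  rw [update_comp_eq_of_injective _ σ.injective, update_comp_eq_of_injective _ σ.injective]
  simp only [comp_apply]
  by_cases h : A a (w (σ j)) l (m (σ j)) = 0
  · simp [h]
  have h1 := permSign_mul_permSign_update σ (hA.odd _ _ _ _ h)
  have h2 := permSign_mul_self σ (isOdd ∘ update w (σ j) a)
  have h3 := passSign_mul_self (w ∘ σ) j
  have h4 : permSign σ (isOdd ∘ w) * passSign (w ∘ σ) j =
      passSign w (σ j) * permSign σ (isOdd ∘ update w (σ j) a) := by
    linear_combination (-(permSign σ (isOdd ∘ w) * passSign (w ∘ σ) j)) * h2 +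
      (passSign (w ∘ σ) j * permSign σ (isOdd ∘ update w (σ j) a)) * h1 +
      (passSign w (σ j) * permSign σ (isOdd ∘ update w (σ j) a)) * h3
  linear_combination (A a (w (σ j)) l (m (σ j)) * C (update (w ∘ σ) j a) (update (m ∘ σ) j l)) * h4

lemma act_add (σ : Equiv.Perm (Fin (I + 1))) (C E : Coeff I) :
    act σ (C + E) = act σ C + act σ E := by
  funext w m
  simp [act, mul_add]

lemma act_sum (σ : Equiv.Perm (Fin (I + 1))) {ι : Type*} (t : Finset ι) (C : ι → Coeff I) :
    act σ (∑ i ∈ t, C i) = ∑ i ∈ t, act σ (C i) := by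
  funext w m
  simp [act, Finset.sum_apply, Finset.mul_sum]

lemma act_smul (σ : Equiv.Perm (Fin (I + 1))) (c : ℂ) (C : Coeff I) :
    act σ (c • C) = c • act σ C := by
  funext w m
  simp [act, mul_left_comm]

lemma act_derivOn {A : Kernel} (hA : IsLocalKernel A) (σ : Equiv.Perm (Fin (I + 1)))
    (C : Coeff I) : act σ (derivOn Finset.univ A C) = derivOn Finset.univ A (act σ C) := by
  rw [derivOn, act_sum]
  simp only [act_slot hA]
  exact Equiv.sum_comp σ fun j => slot A j (act σ C)

/-- Graded symmetry of the coefficients of order `I + 1`. -/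
def IsSymm (C : Coeff I) : Prop := ∀ σ, act σ C = C

/-- Adjacent transpositions generate the symmetric group, and the signs compose by the cocycle
identity. -/
lemma isGradedSymmetric_iff {S : Functional} : IsGradedSymmetric S ↔ ∀ I, IsSymm (S I) := by
  have hsq : ∀ b : Bool, (if b = true then (-1 : ℂ) else 1) * (if b = true then -1 else 1) = 1 := by
    rintro (_ | _) <;> norm_num
  refine forall_congr' fun I => ⟨fun h σ => ?_, fun h w m i => ?_⟩
  · have hσ : σ ∈ Submonoid.closure
        (Set.range fun i : Fin I => Equiv.swap i.castSucc i.succ) := by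
      rw [Equiv.Perm.mclosure_swap_castSucc_succ]
      trivial
    induction hσ using Submonoid.closure_induction with
    | mem τ hτ =>
      obtain ⟨i, rfl⟩ := hτ
      funext w m
      simp only [act, permSign_swap, h w m i, comp_apply]
      rw [← mul_assoc, hsq, one_mul]
    | one => exact act_one _
    | mul σ τ _ _ hσ hτ => rw [← act_act, hτ, hσ]
  · have h1 := congrFun (congrFun (h (Equiv.swap i.castSucc i.succ)) w) m
    simp only [act, permSign_swap, comp_apply] at h1
    rw [← h1, ← mul_assoc, hsq, one_mul]

lemma IsSymm.derivOn {A : Kernel} (hA : IsLocalKernel A) {C : Coeff I} (hC : IsSymm C) :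
    IsSymm (derivOn Finset.univ A C) := fun σ => by rw [act_derivOn hA, hC]

lemma IsSymm.wordMul {θ : (Fin (I + 1) → Species) → ℂ}
    (hθ : ∀ (w : Fin (I + 1) → Species) (σ : Equiv.Perm (Fin (I + 1))), θ (w ∘ σ) = θ w)
    {C : Coeff I} (hC : IsSymm C) : IsSymm (wordMul θ C) := fun σ => by
  funext w m
  have h1 := congrFun (congrFun (hC σ) w) m
  simp only [act] at h1
  simp only [act, LatticeSUSY.wordMul, hθ]
  rw [mul_left_comm, h1]

lemma IsSymm.add {C E : Coeff I} (hC : IsSymm C) (hE : IsSymm E) : IsSymm (C + E) := fun σ => by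
  rw [act_add, hC, hE]

lemma IsSymm.smul (c : ℂ) {C : Coeff I} (hC : IsSymm C) : IsSymm (c • C) := fun σ => by
  rw [act_smul, hC]

/-- The average over all permutations of the factors. -/
noncomputable def symmetrize (C : Coeff I) : Coeff I :=
  (Fintype.card (Equiv.Perm (Fin (I + 1))) : ℂ)⁻¹ • ∑ σ, act σ C

lemma isSymm_symmetrize (C : Coeff I) : IsSymm (symmetrize C) := fun σ => by
  unfold symmetrize
  rw [act_smul, act_sum]
  simp only [act_act]
  congr 1
  exact Equiv.sum_comp (Equiv.mulLeft σ) fun τ => act τ C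

lemma symmetrize_eq_self {C : Coeff I} (hC : IsSymm C) : symmetrize C = C := by
  unfold symmetrize
  simp only [hC _, Finset.sum_const, Finset.card_univ]
  rw [← Nat.cast_smul_eq_nsmul ℂ, smul_smul, inv_mul_cancel₀, one_smul]
  exact_mod_cast Fintype.card_ne_zero

lemma symmetrize_mem {C : Coeff I} (hC : C ∈ localCoeff I) : symmetrize C ∈ localCoeff I :=
  Submodule.smul_mem _ _ (Submodule.sum_mem _ fun σ _ => act_mem σ hC)

lemma derivOn_symmetrize {A : Kernel} (hA : IsLocalKernel A) {C : Coeff I}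
    (hC : C ∈ localCoeff I) :
    derivOn Finset.univ A (symmetrize C) = symmetrize (derivOn Finset.univ A C) := by
  unfold symmetrize
  rw [derivOn_smul, derivOn_sum hA _ _ fun σ _ => act_mem σ hC]
  simp only [act_derivOn hA]

end Symmetrization

end LatticeSUSY

/-! ### Supercharges and their contracting homotopies -/

namespace LatticeSUSY

open Function

section Supercharges

variable {I : ℕ} {D : ℤ → ℤ → ℂ}

/-- The contracting homotopy `χ̄_+ ↦ φ_+`, `F_+ ↦ χ_+` of `Q_+` on the fields of sign `+`. -/
noncomputable def homotopyPlus : Kernel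
  | (.chibar, .plus), (.phi, .plus), m, n => kronecker m n
  | (.aux, .plus), (.chi, .plus), m, n => kronecker m n
  | _, _, _, _ => 0

/-- The contracting homotopy `χ̄_- ↦ -φ_-`, `F_- ↦ χ_-` of `Q_-` on the fields of sign `-`. -/
noncomputable def homotopyMinus : Kernel
  | (.chibar, .minus), (.phi, .minus), m, n => -kronecker m n
  | (.aux, .minus), (.chi, .minus), m, n => kronecker m n
  | _, _, _, _ => 0

lemma isLocalMatrix_neg_kronecker : IsLocalMatrix fun m n => -kronecker m n := by
  simpa using isLocalMatrix_kronecker.const_mul (-1)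

lemma isLocalKernel_deltaPlus (hD : IsLocalMatrix D) : IsLocalKernel (deltaPlus D) := by
  constructor
  · rintro ⟨_ | _ | _ | _, _ | _⟩ ⟨_ | _ | _ | _, _ | _⟩ <;>
      first
      | exact isLocalMatrix_zero
      | exact isLocalMatrix_kronecker
      | exact hD.const_mul _
  · rintro ⟨_ | _ | _ | _, _ | _⟩ ⟨_ | _ | _ | _, _ | _⟩ l m h <;>
      first
      | exact absurd rfl h
      | simp [isOdd]

lemma isLocalKernel_deltaMinus (hD : IsLocalMatrix D) : IsLocalKernel (deltaMinus D) := by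
  constructor
  · rintro ⟨_ | _ | _ | _, _ | _⟩ ⟨_ | _ | _ | _, _ | _⟩ <;>
      first
      | exact isLocalMatrix_zero
      | exact isLocalMatrix_kronecker
      | exact isLocalMatrix_neg_kronecker
      | exact hD.const_mul _
  · rintro ⟨_ | _ | _ | _, _ | _⟩ ⟨_ | _ | _ | _, _ | _⟩ l m h <;>
      first
      | exact absurd rfl h
      | simp [isOdd]

lemma isLocalKernel_homotopyPlus : IsLocalKernel homotopyPlus := by
  constructor
  · rintro ⟨_ | _ | _ | _, _ | _⟩ ⟨_ | _ | _ | _, _ | _⟩ <;>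
      first
      | exact isLocalMatrix_zero
      | exact isLocalMatrix_kronecker
  · rintro ⟨_ | _ | _ | _, _ | _⟩ ⟨_ | _ | _ | _, _ | _⟩ l m h <;>
      first
      | exact absurd rfl h
      | simp [isOdd]

lemma isLocalKernel_homotopyMinus : IsLocalKernel homotopyMinus := by
  constructor
  · rintro ⟨_ | _ | _ | _, _ | _⟩ ⟨_ | _ | _ | _, _ | _⟩ <;>
      first
      | exact isLocalMatrix_zero
      | exact isLocalMatrix_kronecker
      | exact isLocalMatrix_neg_kronecker
  · rintro ⟨_ | _ | _ | _, _ | _⟩ ⟨_ | _ | _ | _, _ | _⟩ l m h <;>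
      first
      | exact absurd rfl h
      | simp [isOdd]

lemma deltaPlus_snd {a b : Species} {l m : ℤ} (h : deltaPlus D a b l m ≠ 0) : a.2 = b.2 := by
  revert h
  rcases a with ⟨_ | _ | _ | _, _ | _⟩ <;> rcases b with ⟨_ | _ | _ | _, _ | _⟩ <;> intro h <;>
    first
    | rfl
    | exact absurd rfl h

lemma deltaMinus_snd {a b : Species} {l m : ℤ} (h : deltaMinus D a b l m ≠ 0) : a.2 = b.2 := by
  revert h
  rcases a with ⟨_ | _ | _ | _, _ | _⟩ <;> rcases b with ⟨_ | _ | _ | _, _ | _⟩ <;> intro h <;>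
    first
    | rfl
    | exact absurd rfl h

lemma homotopyPlus_ne_zero {a b : Species} {l m : ℤ} (h : homotopyPlus a b l m ≠ 0) :
    a.2 = b.2 ∧ fermionNumber b = fermionNumber a + 1 := by
  revert h
  rcases a with ⟨_ | _ | _ | _, _ | _⟩ <;> rcases b with ⟨_ | _ | _ | _, _ | _⟩ <;> intro h <;>
    first
    | exact ⟨rfl, rfl⟩
    | exact absurd rfl h

lemma homotopyMinus_ne_zero {a b : Species} {l m : ℤ} (h : homotopyMinus a b l m ≠ 0) :
    a.2 = b.2 ∧ fermionNumber b = fermionNumber a + 1 := by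
  revert h
  rcases a with ⟨_ | _ | _ | _, _ | _⟩ <;> rcases b with ⟨_ | _ | _ | _, _ | _⟩ <;> intro h <;>
    first
    | exact ⟨rfl, rfl⟩
    | exact absurd rfl h

/-- Each supercharge is a Koszul differential on the fields of the opposite label; this is where the
exactness theorem enters. -/
lemma deltaPlus_eq_koszul {a b : Species} (h : a.2 = .minus) :
    deltaPlus D a b = koszul D .minus (-Complex.I) (-Complex.I) a b := by
  funext l m
  rcases a with ⟨_ | _ | _ | _, _ | _⟩ <;> rcases b with ⟨_ | _ | _ | _, _ | _⟩ <;>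
    first
    | cases h; done
    | simp [deltaPlus, koszul, raise, isUp, koszulCoeff]

lemma deltaMinus_eq_koszul {a b : Species} (h : a.2 = .plus) :
    deltaMinus D a b = koszul D .plus Complex.I (-Complex.I) a b := by
  funext l m
  rcases a with ⟨_ | _ | _ | _, _ | _⟩ <;> rcases b with ⟨_ | _ | _ | _, _ | _⟩ <;>
    first
    | cases h; done
    | simp [deltaMinus, koszul, raise, isUp, koszulCoeff]

lemma sum_species (f : Species → ℂ) : ∑ a, f a =
    f (.phi, .plus) + f (.phi, .minus) + (f (.chibar, .plus) + f (.chibar, .minus)) +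
      (f (.chi, .plus) + f (.chi, .minus)) + (f (.aux, .plus) + f (.aux, .minus)) := by
  rw [Fintype.sum_prod_type]
  have h1 : (Finset.univ : Finset Kind) = {.phi, .chibar, .chi, .aux} := rfl
  have h2 : (Finset.univ : Finset Sgn) = {.plus, .minus} := rfl
  simp [h1, h2, add_assoc]

lemma tsum_kronecker_mul (f : ℤ → ℂ) (n : ℤ) : ∑' l, kronecker l n * f l = f n := by
  rw [tsum_eq_single n fun l hl => by simp [kronecker, hl]]
  simp [kronecker]

/-- The composition of two kernels, applied to `G`. -/
noncomputable def kernelComp (A B : Kernel) (G : Species → ℤ → ℂ) (b : Species) (n : ℤ) : ℂ :=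
  ∑ a : Species, ∑' l : ℤ, A a b l n * ∑ c : Species, ∑' l' : ℤ, B c a l' l * G c l'

/-- If the anticommutator multiplies each letter by a scalar, it multiplies a word by the sum of
these scalars. This gives the anticommuting supercharges and the counting operators from a check on
single letters. -/
theorem derivOn_anticomm_eq {A B : Kernel} (hA : IsLocalKernel A) (hB : IsLocalKernel B)
    {c : Species → ℂ}
    (h : ∀ G b n, kernelComp A B G b n + kernelComp B A G b n = c b * G b n)
    {C : Coeff I} (hC : C ∈ localCoeff I) :
    derivOn Finset.univ A (derivOn Finset.univ B C) + derivOn Finset.univ B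
      (derivOn Finset.univ A C) = wordMul (fun w => ∑ j, c (w j)) C := by
  rw [derivOn_anticomm hA hB _ hC]
  funext w m
  simp only [Finset.sum_apply, Pi.add_apply, wordMul, Finset.sum_mul]
  refine Finset.sum_congr rfl fun j _ => ?_
  rw [slot_slot_self, slot_slot_self]
  have := h (fun b l => C (update w j b) (update m j l)) (w j) (m j)
  simp only [update_eq_self] at this
  exact this

lemma kernelComp_deltaPlus_deltaMinus (G : Species → ℤ → ℂ) (b : Species) (n : ℤ) :
    kernelComp (deltaPlus D) (deltaMinus D) G b n +
      kernelComp (deltaMinus D) (deltaPlus D) G b n = 0 * G b n := by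
  rcases b with ⟨_ | _ | _ | _, _ | _⟩ <;>
    simp [kernelComp, sum_species, deltaPlus, deltaMinus, tsum_kronecker_mul, tsum_mul_left,
      mul_assoc, tsum_neg]

lemma kernelComp_deltaPlus_homotopyPlus (G : Species → ℤ → ℂ) (b : Species) (n : ℤ) :
    kernelComp (deltaPlus D) homotopyPlus G b n + kernelComp homotopyPlus (deltaPlus D) G b n =
      (if b.2 = .plus then 1 else 0) * G b n := by
  rcases b with ⟨_ | _ | _ | _, _ | _⟩ <;>
    simp [kernelComp, sum_species, deltaPlus, homotopyPlus, tsum_kronecker_mul, tsum_mul_left,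
      mul_assoc, tsum_neg]

lemma kernelComp_deltaMinus_homotopyMinus (G : Species → ℤ → ℂ) (b : Species) (n : ℤ) :
    kernelComp (deltaMinus D) homotopyMinus G b n + kernelComp homotopyMinus (deltaMinus D) G b n =
      (if b.2 = .minus then 1 else 0) * G b n := by
  rcases b with ⟨_ | _ | _ | _, _ | _⟩ <;>
    simp [kernelComp, sum_species, deltaMinus, homotopyMinus, tsum_kronecker_mul, tsum_mul_left,
      mul_assoc, tsum_neg]

lemma kernelComp_deltaPlus_homotopyMinus (G : Species → ℤ → ℂ) (b : Species) (n : ℤ) :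
    kernelComp (deltaPlus D) homotopyMinus G b n + kernelComp homotopyMinus (deltaPlus D) G b n =
      0 * G b n := by
  rcases b with ⟨_ | _ | _ | _, _ | _⟩ <;>
    simp [kernelComp, sum_species, deltaPlus, homotopyMinus, tsum_kronecker_mul, tsum_mul_left,
      mul_assoc, tsum_neg]

lemma kernelComp_deltaMinus_homotopyPlus (G : Species → ℤ → ℂ) (b : Species) (n : ℤ) :
    kernelComp (deltaMinus D) homotopyPlus G b n + kernelComp homotopyPlus (deltaMinus D) G b n =
      0 * G b n := by
  rcases b with ⟨_ | _ | _ | _, _ | _⟩ <;>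
    simp [kernelComp, sum_species, deltaMinus, homotopyPlus, tsum_kronecker_mul, tsum_mul_left,
      mul_assoc, tsum_neg]

end Supercharges

end LatticeSUSY

/-! ### Cyclic Leibniz rule as a cycle condition -/

namespace LatticeSUSY

open Function

section CLR

variable {I : ℕ} {D : ℤ → ℤ → ℂ} {s : Sgn} {α β : ℂ}

/-- Every monomial that occurs in `C` has fermion number `N`. -/
def HasNumber (C : Coeff I) (N : ℤ) : Prop :=
  ∀ w m, C w m ≠ 0 → ∑ i, fermionNumber (w i) = N

lemma sum_fermionNumber_update (w : Fin (I + 1) → Species) (j : Fin (I + 1)) (a : Species) :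
    ∑ i, fermionNumber (update w j a i) + fermionNumber (w j) =
      ∑ i, fermionNumber (w i) + fermionNumber a := by
  rw [← Finset.add_sum_erase _ _ (Finset.mem_univ j),
    ← Finset.add_sum_erase (a := j) _ (fun i => fermionNumber (w i)) (Finset.mem_univ j),
    update_self, Finset.sum_congr rfl fun i hi => by rw [update_of_ne (Finset.ne_of_mem_erase hi)]]
  ring

lemma HasNumber.derivOn {A : Kernel} {J : Finset (Fin (I + 1))}
    (hA : ∀ a b l m, A a b l m ≠ 0 → fermionNumber b = fermionNumber a + 1) {C : Coeff I} {N : ℤ}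
    (hC : HasNumber C N) : HasNumber (derivOn J A C) (N + 1) := by
  intro w m h
  obtain ⟨j, -, a, l, hAa, hCa⟩ := exists_of_derivOn_ne_zero h
  have h1 := hC _ _ hCa
  have h2 := hA _ _ _ _ hAa
  have h3 := sum_fermionNumber_update w j a
  omega

lemma fermionNumber_raise {b : Species} (h : isUp b = false) :
    fermionNumber (raise b) = fermionNumber b + 1 := by
  rcases b with ⟨_ | _ | _ | _, _⟩ <;> first | rfl | cases h

lemma fermionNumber_le (b : Species) : fermionNumber b ≤ if isUp b = true then 1 else 0 := by
  rcases b with ⟨_ | _ | _ | _, _⟩ <;> simp [fermionNumber, isUp]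

lemma sum_fermionNumber_le_upCount (w : Fin (I + 1) → Species) :
    ∑ i, fermionNumber (w i) ≤ upCount w := by
  refine (Finset.sum_le_sum fun i _ => fermionNumber_le (w i)).trans_eq ?_
  simp [upCount]

/-- The word `φ_s ⋯ χ_s ⋯ φ_s` with `χ_s` in the position `j`. -/
def chiWord (s : Sgn) (j : Fin (I + 1)) : Fin (I + 1) → Species := fun i =>
  if i = j then (Kind.chi, s) else (Kind.phi, s)

lemma chiWord_injective : Injective (chiWord s : Fin (I + 1) → Fin (I + 1) → Species) := by
  intro j k h
  have := congrFun h j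
  by_contra hne
  simp [chiWord, hne] at this

lemma chiWord_comp (σ : Equiv.Perm (Fin (I + 1))) (j : Fin (I + 1)) :
    chiWord s (σ j) ∘ σ = chiWord s j := by
  funext i
  simp [chiWord]

/-- Only χ carries positive fermion number, so the single up letter is χ and no χ̄ can occur. -/
lemma eq_chiWord {w : Fin (I + 1) → Species} (hs : IsPure s w) (hup : upCount w = 1)
    (hN : ∑ i, fermionNumber (w i) = 1) : ∃ j, w = chiWord s j := by
  obtain ⟨j, hj⟩ := Finset.card_eq_one.mp hup
  have hlow : ∀ i, i ≠ j → isUp (w i) = false := fun i hi => by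
    by_contra h
    have : i ∈ Finset.univ.filter fun i => isUp (w i) = true := by simpa using h
    rw [hj] at this
    exact hi (Finset.mem_singleton.mp this)
  have hle : ∀ i ∈ Finset.univ.erase j, fermionNumber (w i) ≤ 0 := fun i hi => by
    have := fermionNumber_le (w i)
    simpa [hlow i (Finset.ne_of_mem_erase hi)] using this
  rw [← Finset.add_sum_erase _ _ (Finset.mem_univ j)] at hN
  have h1 := Finset.sum_nonpos hle
  have h2 : fermionNumber (w j) ≤ 1 := by
    have := fermionNumber_le (w j)
    split_ifs at this <;> omega
  have h3 : ∑ i ∈ Finset.univ.erase j, fermionNumber (w i) = 0 := by omega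
  have h4 := (Finset.sum_eq_zero_iff_of_nonpos hle).mp h3
  refine ⟨j, funext fun i => Prod.ext ?_ ?_⟩
  · by_cases hi : i = j
    · subst hi
      have h5 : fermionNumber (w i) = 1 := by omega
      generalize w i = b at h5
      rcases b with ⟨_ | _ | _ | _, _⟩ <;> simp_all [fermionNumber, chiWord]
    · have h5 := h4 i (by simp [hi])
      have h6 := hlow i hi
      generalize w i = b at h5 h6
      rcases b with ⟨_ | _ | _ | _, _⟩ <;>
        simp_all [fermionNumber, isUp, chiWord]
  · rw [hs i]
    simp only [chiWord]
    split_ifs <;> rfl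

/-- There is only one odd letter, so no Grassmann sign arises. -/
lemma IsSymm.apply_chiWord {C : Coeff I} (hC : IsSymm C) (σ : Equiv.Perm (Fin (I + 1)))
    (j : Fin (I + 1)) (m : Fin (I + 1) → ℤ) :
    C (chiWord s j) (m ∘ σ) = C (chiWord s (σ j)) m := by
  have h := congrFun (congrFun (hC σ) (chiWord s (σ j))) m
  rw [act, chiWord_comp, permSign_eq_one, one_mul] at h
  · exact h
  · intro i k hi hk
    have h1 : ∀ i, isOdd (chiWord s (σ j) i) = true → i = σ j := fun i hi => by
      by_contra h0
      simp [chiWord, h0, isOdd] at hi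
    rw [h1 i hi, h1 k hk]

/-- The part of order `I + 1` of `chiPhiFunctional`. -/
noncomputable def chiPhiCoeff (s : Sgn) (c : (Fin (I + 1) → ℤ) → ℂ) : Coeff I := fun w m =>
  (1 / ((I : ℂ) + 1)) * ∑ j : Fin (I + 1), if w = chiWord s j then
    c (Fin.cons (m j) (fun i : Fin I => m (j.succAbove i))) else 0

lemma chiPhiFunctional_apply (s : Sgn) (C : (k : ℕ) → (Fin (k + 1) → ℤ) → ℂ) (I : ℕ) :
    chiPhiFunctional s C I = chiPhiCoeff s (C I) := rfl

lemma chiPhiCoeff_zero : chiPhiCoeff s (0 : (Fin (I + 1) → ℤ) → ℂ) = 0 := by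
  funext w m
  simp [chiPhiCoeff]

lemma isCLRCoefficient_zero (D : ℤ → ℤ → ℂ) (k : ℕ) :
    IsCLRCoefficient D (0 : (Fin (k + 1) → ℤ) → ℂ) :=
  ⟨isTILC_zero, fun _ _ _ => rfl, fun n => by simp⟩

lemma cons_succAbove (m : Fin (I + 1) → ℤ) (j : Fin (I + 1)) :
    (Fin.cons (m j) (fun i : Fin I => m (j.succAbove i)) : Fin (I + 1) → ℤ) =
      m ∘ j.cycleRange.symm := by
  funext i
  refine Fin.cases ?_ (fun i => ?_) i
  · simp [Fin.cycleRange_symm_zero]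
  · simp [Fin.cycleRange_symm_succ]

lemma cons_add_succ (n : Fin (I + 1) → ℤ) (p : Fin (I + 1)) (l : ℤ) :
    (Fin.cons l (fun i : Fin I => n (p + i.succ)) : Fin (I + 1) → ℤ) =
      update n p l ∘ Equiv.addLeft p := by
  funext i
  refine Fin.cases ?_ (fun i => ?_) i
  · simp
  · have : p + i.succ ≠ p := by
      intro h
      exact Fin.succ_ne_zero i (add_eq_left.mp h)
    simp [this]

lemma chiWord_of_update_raise (p : Fin (I + 1)) :
    update (fun _ : Fin (I + 1) => (Kind.phi, s)) p (raise (Kind.phi, s)) = chiWord s p := by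
  funext i
  by_cases h : i = p
  · subst h; simp [chiWord, raise]
  · simp [chiWord, h]

lemma exists_isCLRCoefficient (hα : α ≠ 0) {R : Coeff I} (hR : R ∈ localCoeff I) (hsymm : IsSymm R)
    (hs : ∀ w m, R w m ≠ 0 → IsPure s w ∧ upCount w = 1) (hN : HasNumber R 1)
    (hKR : derivOn Finset.univ (koszul D s α β) R = 0) :
    ∃ c : (Fin (I + 1) → ℤ) → ℂ, IsCLRCoefficient D c ∧ chiPhiCoeff s c = R := by
  have hI : (I : ℂ) + 1 ≠ 0 := by exact_mod_cast Nat.succ_ne_zero I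
  -- A given word matches a single position of χ in `chiPhiCoeff`, so the factor `I + 1` undoes the
  -- equal distribution over positions.
  refine ⟨((I : ℂ) + 1) • R (chiWord s 0), ⟨(hR _).const_mul _, fun σ m n => ?_, fun n => ?_⟩, ?_⟩
  · have h1 : (Fin.cons m (n ∘ σ) : Fin (I + 1) → ℤ) =
        (Fin.cons m n : Fin (I + 1) → ℤ) ∘ (Equiv.Perm.decomposeFin.symm (0, σ)) := by
      funext i
      refine Fin.cases ?_ (fun i => ?_) i
      · simp
      · simp
    rw [h1, Pi.smul_apply, Pi.smul_apply, hsymm.apply_chiWord]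
    simp
  -- The cycle condition at the word φ⋯φ sums over the position `p` of χ. Rotating `p` to the front
  -- by graded symmetry turns it into the cyclic sum.
  · have h1 := congrFun (congrFun hKR fun _ => (Kind.phi, s)) n
    rw [derivOn_apply] at h1
    have hpass : ∀ p : Fin (I + 1), passSign (fun _ : Fin (I + 1) => (Kind.phi, s)) p = 1 := by
      intro p
      simp [passSign, isOdd]
    simp only [slot_koszul, isUp, true_and, if_true, hpass, one_mul, koszulCoeff,
      chiWord_of_update_raise, ← Finset.mul_sum] at h1
    have h2 := (mul_eq_zero.mp h1).resolve_left hα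
    have h3 : ∀ p l, (((I : ℂ) + 1) • R (chiWord s 0))
        (Fin.cons l fun i : Fin I => n (p + i.succ)) =
        ((I : ℂ) + 1) * R (chiWord s p) (update n p l) := fun p l => by
      rw [cons_add_succ, Pi.smul_apply, hsymm.apply_chiWord, smul_eq_mul]
      simp
    simp only [h3, mul_left_comm _ ((I : ℂ) + 1), tsum_mul_left, ← Finset.mul_sum]
    rw [h2, mul_zero]
  · funext w m
    by_cases hw : ∃ j, w = chiWord s j
    · obtain ⟨j, rfl⟩ := hw
      simp only [chiPhiCoeff]
      rw [Finset.sum_eq_single j (fun k _ hk => if_neg fun h => hk (chiWord_injective h).symm)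
        (fun h => absurd (Finset.mem_univ _) h), if_pos rfl, cons_succAbove, Pi.smul_apply,
        hsymm.apply_chiWord, Fin.cycleRange_symm_zero, smul_eq_mul]
      field_simp
    · have h1 : R w m = 0 := by
        by_contra h0
        obtain ⟨h2, h3⟩ := hs w m h0
        exact hw (eq_chiWord h2 h3 (hN w m h0))
      rw [h1]
      simp only [chiPhiCoeff]
      rw [Finset.sum_eq_zero fun j _ => if_neg fun h => hw ⟨j, h⟩, mul_zero]

end CLR

/-! ### Projection onto classes of words -/

section Restrict

variable {I : ℕ}

open Classical in
/-- The part of `C` with words in `P`. -/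
noncomputable def restrict (P : (Fin (I + 1) → Species) → Prop) (C : Coeff I) : Coeff I :=
  wordMul (fun w => if P w then 1 else 0) C

variable {P Q : (Fin (I + 1) → Species) → Prop} {C : Coeff I}

lemma restrict_mem (P : (Fin (I + 1) → Species) → Prop) (hC : C ∈ localCoeff I) :
    restrict P C ∈ localCoeff I := wordMul_mem _ hC

lemma restrict_apply {w : Fin (I + 1) → Species} (h : P w) (m : Fin (I + 1) → ℤ) :
    restrict P C w m = C w m := by
  simp [restrict, wordMul, h]

lemma restrict_apply_of_not {w : Fin (I + 1) → Species} (h : ¬ P w) (m : Fin (I + 1) → ℤ) :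
    restrict P C w m = 0 := by
  simp [restrict, wordMul, h]

lemma of_restrict_ne_zero {w : Fin (I + 1) → Species} {m : Fin (I + 1) → ℤ}
    (h : restrict P C w m ≠ 0) : P w ∧ C w m ≠ 0 :=
  ⟨by
    by_contra hP
    exact h (restrict_apply_of_not hP m), right_ne_zero_of_mul h⟩

lemma restrict_zero (P : (Fin (I + 1) → Species) → Prop) : restrict P (0 : Coeff I) = 0 := by
  funext w m
  simp [restrict, wordMul]

lemma IsSymm.restrict (hP : ∀ (w : Fin (I + 1) → Species) (σ : Equiv.Perm (Fin (I + 1))),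
    P (w ∘ σ) ↔ P w) (hC : IsSymm C) : IsSymm (restrict P C) :=
  hC.wordMul fun w σ => by rw [propext (hP w σ)]

lemma derivOn_restrict {A : Kernel} {J : Finset (Fin (I + 1))}
    (h : ∀ (w : Fin (I + 1) → Species) (j : Fin (I + 1)) (a : Species) (l m : ℤ),
      A a (w j) l m ≠ 0 → (P (update w j a) ↔ Q w)) (C : Coeff I) :
    derivOn J A (restrict P C) = restrict Q (derivOn J A C) :=
  derivOn_wordMul fun w j _ a l m hA _ => by rw [propext (h w j a l m hA)]

end Restrict

/-! ### Invariants with fields of one label -/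

section Pure

variable {I : ℕ} {D : ℤ → ℤ → ℂ} {s : Sgn} {α β : ℂ}

lemma derivOn_congr {A B : Kernel} {C : Coeff I} (hC : ∀ w m, C w m ≠ 0 → IsPure s w)
    (h : ∀ a b, a.2 = s → A a b = B a b) (J : Finset (Fin (I + 1))) :
    derivOn J A C = derivOn J B C := by
  funext w m
  simp only [derivOn_apply]
  refine Finset.sum_congr rfl fun j _ => slot_congr (fun a ⟨m', hm'⟩ => h _ _ ?_) m
  simpa using hC _ _ hm' j

lemma isPure_comp (w : Fin (I + 1) → Species) (σ : Equiv.Perm (Fin (I + 1))) :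
    IsPure s (w ∘ σ) ↔ IsPure s w :=
  ⟨fun h i => by simpa using h (σ.symm i), fun h i => h (σ i)⟩

lemma sum_fermionNumber_comp (w : Fin (I + 1) → Species) (σ : Equiv.Perm (Fin (I + 1))) :
    ∑ i, fermionNumber ((w ∘ σ) i) = ∑ i, fermionNumber (w i) :=
  Equiv.sum_comp σ fun i => fermionNumber (w i)

lemma upCount_comp (w : Fin (I + 1) → Species) (σ : Equiv.Perm (Fin (I + 1))) :
    upCount (w ∘ σ) = upCount w := by
  unfold upCount
  simp only [Finset.card_filter]
  exact Equiv.sum_comp σ fun i => if isUp (w i) = true then 1 else 0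

/-- A Koszul cycle of fermion number `1` is a Koszul boundary plus a CLR term. -/
lemma exists_eq_koszul_add_chiPhi (hD : IsDifferenceOperator D) (hα : α ≠ 0) (hβ : β ≠ 0)
    {R : Coeff I} (hR : R ∈ localCoeff I) (hsymm : IsSymm R) (hs : ∀ w m, R w m ≠ 0 → IsPure s w)
    (hN : HasNumber R 1) (hKR : derivOn Finset.univ (koszul D s α β) R = 0) :
    ∃ U ∈ localCoeff I, IsSymm U ∧ HasNumber U 2 ∧ (∀ w m, U w m ≠ 0 → IsPure s w) ∧
      ∃ c, IsCLRCoefficient D c ∧ chiPhiCoeff s c ∈ localCoeff I ∧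
        R = derivOn Finset.univ (koszul D s α β) U + chiPhiCoeff s c := by
  have hK := isLocalKernel_koszul hD.isLocalMatrix s α β
  -- The differential lowers the number of up letters by exactly one, so each graded component of a
  -- cycle is itself a cycle.
  have hcl : ∀ P : ℕ → Prop, derivOn Finset.univ (koszul D s α β)
      (restrict (fun w => P (upCount w)) R) = 0 := fun P => by
    rw [derivOn_restrict (Q := fun w => P (upCount w + 1)), hKR, restrict_zero]
    intro w j a l m h
    obtain ⟨rfl, h1, -⟩ := koszul_ne_zero h
    rw [upCount_update_raise h1]
  have hsy : ∀ P : ℕ → Prop, IsSymm (restrict (fun w => P (upCount w)) R) := fun P =>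
    hsymm.restrict fun w σ => by rw [upCount_comp]
  obtain ⟨c, hc, hcR⟩ := exists_isCLRCoefficient hα (restrict_mem (fun w => upCount w = 1) hR)
    (hsy fun n => n = 1)
    (fun w m h => ⟨hs w m (of_restrict_ne_zero h).2, (of_restrict_ne_zero h).1⟩)
    (fun w m h => hN w m (of_restrict_ne_zero h).2) (hcl fun n => n = 1)
  obtain ⟨U, hU, hKU⟩ := exists_koszul_primitive hD hα hβ
    (restrict_mem (fun w => 2 ≤ upCount w) hR) (hcl fun n => 2 ≤ n)
    (fun w m h => ⟨hs w m (of_restrict_ne_zero h).2, (of_restrict_ne_zero h).1⟩)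
  -- The primitive is averaged to recover graded symmetry, then projected to the required label and
  -- fermion number. The differential lowers the latter by one on contributing words, so its image
  -- keeps `R`.
  refine ⟨restrict (fun w => IsPure s w ∧ ∑ i, fermionNumber (w i) = 2) (symmetrize U),
    restrict_mem _ (symmetrize_mem hU), (isSymm_symmetrize U).restrict fun w σ => by
      rw [isPure_comp, sum_fermionNumber_comp],
    fun w m h => (of_restrict_ne_zero h).1.2, fun w m h => (of_restrict_ne_zero h).1.1, c, hc,
    hcR ▸ restrict_mem _ hR, ?_⟩
  rw [derivOn_restrict (Q := fun w => IsPure s w ∧ ∑ i, fermionNumber (w i) = 1),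
    derivOn_symmetrize hK hU, hKU, symmetrize_eq_self (hsy fun n => 2 ≤ n), hcR]
  · funext w m
    rw [Pi.add_apply, Pi.add_apply]
    by_cases h0 : R w m = 0
    · simp [restrict, wordMul, h0]
    · have h1 := hN w m h0
      have h2 := sum_fermionNumber_le_upCount w
      rw [restrict_apply ⟨hs w m h0, h1⟩]
      rw [h1] at h2
      by_cases h4 : upCount w = 1
      · rw [restrict_apply_of_not (by omega), restrict_apply h4, zero_add]
      · rw [restrict_apply (by omega), restrict_apply_of_not h4, add_zero]
  · intro w j a l m h
    obtain ⟨rfl, h1, -⟩ := koszul_ne_zero h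
    have h2 := sum_fermionNumber_update w j (raise (w j))
    rw [fermionNumber_raise h1] at h2
    rw [isPure_update (snd_raise _)]
    refine and_congr_right fun _ => ?_
    omega

lemma isPure_update_iff {A : Kernel} (hA : ∀ a b l m, A a b l m ≠ 0 → a.2 = b.2)
    {w : Fin (I + 1) → Species} {j : Fin (I + 1)} {a : Species} {l m : ℤ}
    (h : A a (w j) l m ≠ 0) (s : Sgn) : IsPure s (update w j a) ↔ IsPure s w :=
  isPure_update (hA _ _ _ _ h)

/-- The case of fields of one sign: `A` acts as the Koszul differential, `B` has the contracting
homotopy `H`. -/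
lemma exists_pure {A B H : Kernel} (hD : IsDifferenceOperator D) (hα : α ≠ 0) (hβ : β ≠ 0)
    (hA : IsLocalKernel A) (hB : IsLocalKernel B) (hH : IsLocalKernel H)
    (hAK : ∀ a b, a.2 = s → A a b = koszul D s α β a b)
    (hHne : ∀ a b l m, H a b l m ≠ 0 → a.2 = b.2 ∧ fermionNumber b = fermionNumber a + 1)
    (hBH : ∀ G b n, kernelComp B H G b n + kernelComp H B G b n =
      (if b.2 = s then 1 else 0) * G b n)
    (hAH : ∀ G b n, kernelComp A H G b n + kernelComp H A G b n = 0 * G b n)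
    {S : Coeff I} (hS : S ∈ localCoeff I) (hsymm : IsSymm S) (hs : ∀ w m, S w m ≠ 0 → IsPure s w)
    (hN : HasNumber S 0) (hAS : derivOn Finset.univ A S = 0) (hBS : derivOn Finset.univ B S = 0) :
    ∃ U ∈ localCoeff I, IsSymm U ∧ HasNumber U 2 ∧ ∃ c, IsCLRCoefficient D c ∧
      S = derivOn Finset.univ B (derivOn Finset.univ A U) +
        derivOn Finset.univ B (chiPhiCoeff s c) := by
  have hI : (I : ℂ) + 1 ≠ 0 := by exact_mod_cast Nat.succ_ne_zero I
  -- On pure words the homotopy counts all `I + 1` letters; the inverse normalizes it so that B R =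
  -- S.
  set R := ((I : ℂ) + 1)⁻¹ • derivOn Finset.univ H S
  have hR : R ∈ localCoeff I := Submodule.smul_mem _ _ (derivOn_mem hH _ hS)
  have hne : ∀ w m, R w m ≠ 0 → derivOn Finset.univ H S w m ≠ 0 := fun w m h =>
    right_ne_zero_of_mul h
  have hRs : ∀ w m, R w m ≠ 0 → IsPure s w := fun w m h => by
    obtain ⟨j, -, a, l, hHa, hSa⟩ := exists_of_derivOn_ne_zero (hne w m h)
    exact (isPure_update_iff (fun a b l m h => (hHne a b l m h).1) hHa s).mp (hs _ _ hSa)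
  have hRN : HasNumber R 1 := fun w m h =>
    (hN.derivOn fun a b l m h => (hHne a b l m h).2) w m (hne w m h)
  have hKR : derivOn Finset.univ A R = 0 := by
    have h1 := derivOn_anticomm_eq hA hH hAH hS
    rw [hAS, derivOn_zero, add_zero] at h1
    rw [derivOn_smul, h1]
    funext w m
    simp [wordMul]
  have hBR : derivOn Finset.univ B R = S := by
    have h1 := derivOn_anticomm_eq hB hH hBH hS
    rw [hBS, derivOn_zero, add_zero] at h1
    rw [derivOn_smul, h1]
    funext w m
    simp only [Pi.smul_apply, smul_eq_mul, wordMul]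
    by_cases h0 : S w m = 0
    · simp [h0]
    · have h2 : ∀ j, (w j).2 = s := hs w m h0
      simp only [h2, if_true, Finset.sum_const, Finset.card_univ, Fintype.card_fin, nsmul_eq_mul,
        mul_one]
      push_cast
      rw [inv_mul_cancel_left₀ hI]
  rw [derivOn_congr hRs hAK] at hKR
  obtain ⟨U, hU, hUsymm, hUN, hUs, c, hc, hcm, h⟩ := exists_eq_koszul_add_chiPhi hD hα hβ hR
    ((hsymm.derivOn hH).smul _) hRs hRN hKR
  refine ⟨U, hU, hUsymm, hUN, c, hc, ?_⟩
  rw [← derivOn_congr hUs hAK] at h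
  rw [← derivOn_add hB _ (derivOn_mem hA _ hU) hcm, ← h, hBR]

end Pure

/-! ### Mixed words and the full decomposition -/

section Assembly

variable {I : ℕ} {D : ℤ → ℤ → ℂ}

/-- The number of letters of sign `s` of a word. -/
noncomputable def signCount (s : Sgn) (w : Fin (I + 1) → Species) : ℂ :=
  ∑ j, if (w j).2 = s then 1 else 0

lemma signCount_eq_card (s : Sgn) (w : Fin (I + 1) → Species) :
    signCount s w = ((Finset.univ.filter fun j => (w j).2 = s).card : ℂ) := by
  simp [signCount]

lemma signCount_comp (s : Sgn) (w : Fin (I + 1) → Species) (σ : Equiv.Perm (Fin (I + 1))) :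
    signCount s (w ∘ σ) = signCount s w :=
  Equiv.sum_comp σ fun j => if (w j).2 = s then (1 : ℂ) else 0

lemma signCount_update {w : Fin (I + 1) → Species} {j : Fin (I + 1)} {a : Species}
    (h : a.2 = (w j).2) (s : Sgn) : signCount s (update w j a) = signCount s w := by
  refine Finset.sum_congr rfl fun i _ => ?_
  by_cases hi : i = j
  · subst hi; simp [h]
  · simp [hi]

lemma signCount_ne_zero {s : Sgn} {w : Fin (I + 1) → Species} (h : ∃ j, (w j).2 = s) :
    signCount s w ≠ 0 := by
  obtain ⟨j, hj⟩ := h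
  rw [signCount_eq_card, Nat.cast_ne_zero]
  exact (Finset.card_pos.mpr ⟨j, by simp [hj]⟩).ne'

lemma eq_minus_of_ne_plus {s : Sgn} (h : s ≠ .plus) : s = .minus := by
  cases s
  · exact absurd rfl h
  · rfl

lemma eq_plus_of_ne_minus {s : Sgn} (h : s ≠ .minus) : s = .plus := by
  cases s
  · rfl
  · exact absurd rfl h

/-- The case of fields of both signs. -/
lemma exists_mixed (hD : IsDifferenceOperator D) {S : Coeff I} (hS : S ∈ localCoeff I)
    (hsymm : IsSymm S) (hN : HasNumber S 0)
    (hs : ∀ w m, S w m ≠ 0 → ¬ IsPure .plus w ∧ ¬ IsPure .minus w)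
    (hplus : derivOn Finset.univ (deltaPlus D) S = 0)
    (hminus : derivOn Finset.univ (deltaMinus D) S = 0) :
    ∃ T ∈ localCoeff I, IsSymm T ∧ HasNumber T 2 ∧
      S = derivOn Finset.univ (deltaPlus D) (derivOn Finset.univ (deltaMinus D) T) := by
  have hP := isLocalKernel_deltaPlus hD.isLocalMatrix
  have hM := isLocalKernel_deltaMinus hD.isLocalMatrix
  have hHP := isLocalKernel_homotopyPlus
  have hHM := isLocalKernel_homotopyMinus
  -- The sign compensates for moving Q_- past h_+. The weight is a function of the two counts, which
  -- the supercharges preserve.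
  let θ : (Fin (I + 1) → Species) → ℂ := fun w => -(signCount .plus w * signCount .minus w)⁻¹
  have hθ : ∀ {A : Kernel}, (∀ a b l m, A a b l m ≠ 0 → a.2 = b.2) → ∀ C : Coeff I,
      derivOn Finset.univ A (wordMul θ C) = wordMul θ (derivOn Finset.univ A C) := fun hA C =>
    derivOn_wordMul fun w j _ a l m h _ => by
      simp only [θ, signCount_update (hA _ _ _ _ h)]
  set R := derivOn Finset.univ homotopyMinus S
  have hR : R ∈ localCoeff I := derivOn_mem hHM _ hS
  set E := derivOn Finset.univ homotopyPlus R
  have hE : E ∈ localCoeff I := derivOn_mem hHP _ hR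
  have hER : derivOn Finset.univ (deltaMinus D) E =
      -derivOn Finset.univ homotopyPlus (derivOn Finset.univ (deltaMinus D) R) := by
    have h1 := derivOn_anticomm_eq hM hHP kernelComp_deltaMinus_homotopyPlus hR
    refine eq_neg_of_add_eq_zero_left (h1.trans ?_)
    funext w m
    simp [wordMul]
  have hRS : derivOn Finset.univ (deltaMinus D) R = wordMul (signCount .minus) S := by
    have h1 := derivOn_anticomm_eq hM hHM kernelComp_deltaMinus_homotopyMinus hS
    rw [hminus, derivOn_zero, add_zero] at h1
    exact h1
  set S' := wordMul (signCount .minus) S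
  have hS' : S' ∈ localCoeff I := wordMul_mem _ hS
  have hPS' : derivOn Finset.univ (deltaPlus D) S' = 0 := by
    rw [derivOn_wordMul (θ' := signCount .minus) fun w j _ a l m h _ =>
      signCount_update (deltaPlus_snd h) _, hplus]
    funext w m
    simp [wordMul]
  have hPH : derivOn Finset.univ (deltaPlus D) (derivOn Finset.univ homotopyPlus S') =
      wordMul (signCount .plus) S' := by
    have h1 := derivOn_anticomm_eq hP hHP kernelComp_deltaPlus_homotopyPlus hS'
    rw [hPS', derivOn_zero, add_zero] at h1
    exact h1
  refine ⟨wordMul θ E, wordMul_mem _ hE, ((hsymm.derivOn hHM).derivOn hHP).wordMul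
    fun w σ => by simp only [θ, signCount_comp], fun w m h => ?_, ?_⟩
  · have h1 : HasNumber R 1 := hN.derivOn fun a b l m h => (homotopyMinus_ne_zero h).2
    have h2 : HasNumber E 2 := h1.derivOn fun a b l m h => (homotopyPlus_ne_zero h).2
    exact h2 w m (right_ne_zero_of_mul h)
  · rw [hθ fun a b l m => deltaMinus_snd, hθ fun a b l m => deltaPlus_snd, hER, hRS]
    have h1 : -derivOn Finset.univ homotopyPlus S' =
        (-1 : ℂ) • derivOn Finset.univ homotopyPlus S' := by simp
    rw [h1, derivOn_smul, hPH]
    funext w m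
    simp only [wordMul, S', θ, Pi.smul_apply, smul_eq_mul]
    by_cases h0 : S w m = 0
    · simp [h0]
    obtain ⟨h2, h3⟩ := hs w m h0
    have h4 : signCount .plus w ≠ 0 := by
      refine signCount_ne_zero ?_
      by_contra! hcon
      exact h3 fun i => eq_minus_of_ne_plus (hcon i)
    have h5 : signCount .minus w ≠ 0 := by
      refine signCount_ne_zero ?_
      by_contra! hcon
      exact h2 fun i => eq_plus_of_ne_minus (hcon i)
    field_simp

/-- The decomposition of the invariants of one order. -/
theorem exists_decomposition (hD : IsDifferenceOperator D) {S : Coeff I} (hS : S ∈ localCoeff I)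
    (hsymm : IsSymm S) (hN : HasNumber S 0)
    (hplus : derivOn Finset.univ (deltaPlus D) S = 0)
    (hminus : derivOn Finset.univ (deltaMinus D) S = 0) :
    ∃ (T : Coeff I) (c c' : (Fin (I + 1) → ℤ) → ℂ), T ∈ localCoeff I ∧ IsSymm T ∧ HasNumber T 2 ∧
      IsCLRCoefficient D c ∧ IsCLRCoefficient D c' ∧
      (S = 0 → T = 0 ∧ c = 0 ∧ c' = 0) ∧
      S = derivOn Finset.univ (deltaPlus D) (derivOn Finset.univ (deltaMinus D) T) +
        derivOn Finset.univ (deltaPlus D) (chiPhiCoeff .plus c) +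
        derivOn Finset.univ (deltaMinus D) (chiPhiCoeff .minus c') := by
  -- Zero witnesses at the orders absent from `S` ensure that no new orders occur.
  by_cases hS0 : S = 0
  · refine ⟨0, 0, 0, Submodule.zero_mem _, fun σ => by funext w m; simp [act],
      fun w m h => absurd rfl h, isCLRCoefficient_zero D I, isCLRCoefficient_zero D I,
      fun _ => ⟨rfl, rfl, rfl⟩, ?_⟩
    simp [chiPhiCoeff_zero, derivOn_zero, hS0]
  have hloc := hD.isLocalMatrix
  have hP := isLocalKernel_deltaPlus hloc
  have hM := isLocalKernel_deltaMinus hloc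
  have hcl : ∀ (f : Prop → Prop → Prop) {A : Kernel}, (∀ a b l m, A a b l m ≠ 0 → a.2 = b.2) →
      derivOn Finset.univ A S = 0 →
      derivOn Finset.univ A (restrict (fun w => f (IsPure .plus w) (IsPure .minus w)) S) = 0 := by
    intro f A hA h0
    rw [derivOn_restrict (Q := fun w => f (IsPure .plus w) (IsPure .minus w)), h0, restrict_zero]
    intro w j a l m h
    rw [isPure_update_iff hA h, isPure_update_iff hA h]
  have hsy : ∀ f : Prop → Prop → Prop,
      IsSymm (restrict (fun w => f (IsPure .plus w) (IsPure .minus w)) S) := fun f =>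
    hsymm.restrict fun w σ => by rw [isPure_comp, isPure_comp]
  have hnum : ∀ P, HasNumber (restrict P S) 0 := fun P w m h => hN w m (of_restrict_ne_zero h).2
  have hclP := fun f => hcl f (fun a b l m => deltaPlus_snd) hplus
  have hclM := fun f => hcl f (fun a b l m => deltaMinus_snd) hminus
  have hi : Complex.I ≠ 0 := Complex.I_ne_zero
  obtain ⟨U, hU, hUs, hUN, c, hc, h1⟩ := exists_pure (s := .plus) hD hi (neg_ne_zero.mpr hi) hM hP
    isLocalKernel_homotopyPlus (fun a b => deltaMinus_eq_koszul)
    (fun a b l m => homotopyPlus_ne_zero) kernelComp_deltaPlus_homotopyPlus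
    kernelComp_deltaMinus_homotopyPlus (restrict_mem (IsPure .plus) hS) (hsy fun p _ => p)
    (fun w m h => (of_restrict_ne_zero h).1) (hnum _) (hclM fun p _ => p) (hclP fun p _ => p)
  obtain ⟨U', hU', hUs', hUN', c', hc', h2⟩ := exists_pure (s := .minus) hD (neg_ne_zero.mpr hi)
    (neg_ne_zero.mpr hi) hP hM
    isLocalKernel_homotopyMinus (fun a b => deltaPlus_eq_koszul)
    (fun a b l m => homotopyMinus_ne_zero) kernelComp_deltaMinus_homotopyMinus
    kernelComp_deltaPlus_homotopyMinus (restrict_mem (IsPure .minus) hS) (hsy fun _ q => q)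
    (fun w m h => (of_restrict_ne_zero h).1) (hnum _) (hclP fun _ q => q) (hclM fun _ q => q)
  obtain ⟨T, hT, hTs, hTN, h3⟩ := exists_mixed hD
    (restrict_mem (fun w => ¬ IsPure .plus w ∧ ¬ IsPure .minus w) hS)
    (hsy fun p q => ¬ p ∧ ¬ q) (hnum _) (fun w m h => (of_restrict_ne_zero h).1)
    (hclP fun p q => ¬ p ∧ ¬ q) (hclM fun p q => ¬ p ∧ ¬ q)
  -- The `-` sector produces Q_- Q_+ U'; anticommuting the supercharges puts it in the required
  -- order, so `U'` enters `T` with a minus sign.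
  have h4 : derivOn Finset.univ (deltaMinus D) (derivOn Finset.univ (deltaPlus D) U') =
      -derivOn Finset.univ (deltaPlus D) (derivOn Finset.univ (deltaMinus D) U') := by
    have h5 := derivOn_anticomm_eq hP hM kernelComp_deltaPlus_deltaMinus hU'
    refine eq_neg_of_add_eq_zero_right (h5.trans ?_)
    funext w m
    simp [wordMul]
  refine ⟨T + U - U', c, c', Submodule.sub_mem _ (Submodule.add_mem _ hT hU) hU', ?_, ?_, hc, hc',
    fun h => absurd h hS0, ?_⟩
  · have : T + U - U' = T + U + (-1 : ℂ) • U' := by simp [sub_eq_add_neg]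
    rw [this]
    exact (hTs.add hUs).add (hUs'.smul _)
  · intro w m h
    by_cases hT0 : T w m = 0
    · by_cases hU0 : U w m = 0
      · refine hUN' w m fun hU0' => h ?_
        simp [hT0, hU0, hU0']
      · exact hUN w m hU0
    · exact hTN w m hT0
  · have h5 : S = restrict (fun w => ¬ IsPure .plus w ∧ ¬ IsPure .minus w) S +
        restrict (IsPure .plus) S + restrict (IsPure .minus) S := by
      funext w m
      rw [Pi.add_apply, Pi.add_apply, Pi.add_apply, Pi.add_apply]
      by_cases hp : IsPure .plus w
      · have hq : ¬ IsPure .minus w := fun hq => by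
          cases (hp 0).symm.trans (hq 0)
        rw [restrict_apply_of_not fun h => h.1 hp, restrict_apply hp, restrict_apply_of_not hq,
          zero_add, add_zero]
      · by_cases hq : IsPure .minus w
        · rw [restrict_apply_of_not fun h => h.2 hq, restrict_apply_of_not hp, restrict_apply hq,
            zero_add, zero_add]
        · rw [restrict_apply ⟨hp, hq⟩, restrict_apply_of_not hp, restrict_apply_of_not hq,
            add_zero, add_zero]
    have h6 := derivOn_mem hM Finset.univ hT
    have h7 := derivOn_mem hM Finset.univ hU
    have h8 := derivOn_mem hM Finset.univ hU'
    rw [derivOn_sub hM _ (Submodule.add_mem _ hT hU) hU', derivOn_add hM _ hT hU,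
      derivOn_sub hP _ (Submodule.add_mem _ h6 h7) h8, derivOn_add hP _ h6 h7]
    conv_lhs => rw [h5, h1, h2, h3, h4]
    abel

end Assembly

end LatticeSUSY

theorem proposition1 (D : ℤ → ℤ → ℂ) (hD : IsDifferenceOperator D)
    (S : Functional) (hS : IsLocalFunctional S) (hSF : HasFermionNumber S 0)
    (hplus : Qplus D S = 0) (hminus : Qminus D S = 0) :
    ∃ T Cplus Cminus : Functional,
      IsLocalFunctional T ∧ HasFermionNumber T 2 ∧
      IsCLRTerms D Sgn.plus Cplus ∧ IsCLRTerms D Sgn.minus Cminus ∧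
      (∀ I : ℕ, S I = 0 → T I = 0 ∧ Cplus I = 0 ∧ Cminus I = 0) ∧
      S = Qplus D (Qminus D T) + Qplus D Cplus + Qminus D Cminus := by
  have hsymm := isGradedSymmetric_iff.mp hS.1
  -- The supercharges preserve the order in the fields, so the witnesses can be chosen independently
  -- at each order, with no convergence issue over infinitely many orders.
  choose T c c' hT hTs hTN hc hc' h0 h using fun I => exists_decomposition hD (S := S I) (hS.2 I)
    (hsymm I) (hSF I) ((oddDerivation_eq_derivOn _ S I).symm.trans (congrFun hplus I))
    ((oddDerivation_eq_derivOn _ S I).symm.trans (congrFun hminus I))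
  refine ⟨T, chiPhiFunctional .plus c, chiPhiFunctional .minus c',
    ⟨isGradedSymmetric_iff.mpr hTs, hT⟩, hTN, ⟨c, hc, rfl⟩, ⟨c', hc', rfl⟩, fun I hI => ?_, ?_⟩
  · obtain ⟨h1, h2, h3⟩ := h0 I hI
    simp only [chiPhiFunctional_apply, h1, h2, h3, chiPhiCoeff_zero, and_self]
  · funext I
    simp only [Qplus, Qminus, Pi.add_apply, oddDerivation_eq_derivOn, chiPhiFunctional_apply]
    exact h I
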